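/- Let $\nu\ge 2$, $m>0$, $\omega\in\mathbb R$, $\mathcal H=L^2(\mathbb R^\nu)$, and $H_0=p^2/2m=-\frac1{2m}\Delta$, self-adjoint in $\mathcal H$. Let $F(|\mathbf x|>\rho)$ be multiplication by the indicator function of $\{|\mathbf x|>\rho\}$, let $\mathcal R(t)$ be the rotation by the angle $\omega t$ in the $x_1,x_2$-plane, and let $\partial_\phi=x_1\partial_2-x_2\partial_1$. For a vector $\mathbf v\in\mathbb R^\nu$ write $v=|\mathbf v|$. Let $$\mathcal D_0=\{\Phi\in\mathcal H:\ \|\Phi\|=1,\ \widehat\varphi\in C_0^\infty(\mathbb R^\nu),\ \operatorname{supp}\widehat\varphi\subseteq B_{mv/3}(m\mathbf v)\text{ for some }\mathbf v\in\mathbb R^\nu,\ \mathbf v\ne0\},$$ where $\widehat\varphi(\mathbf p)=(2\pi)^{-\nu/2}\int e^{-i\mathbf p\cdot\mathbf x}\Phi(\mathbf x)\,d\mathbf x$ is the momentum space wave function of $\Phi$ and $B_r(\mathbf q)$ is the open ball of radius $r$ with center $\mathbf q$. Let $V:\mathbb R^\nu\to\mathbb R$ be a measurable function that is Kato-bounded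 with respect to $H_0$, i.e. there are $a<1$ and $b<\infty$ with $\|V\Psi\|\le a\|H_0\Psi\|+b\|\Psi\|$ for all $\Psi\in\mathcal D(H_0)$, and let $V_t(\mathbf x)=V(\mathcal R(t)^{-1}\mathbf x)$ be the corresponding rotating potential. **(A)** Assume that one of the following conditions holds: 1. there is $h\in L^1([0,\infty))$ with $\rho\,\|V\,F(|\mathbf x|>\rho)\|\le h(\rho)$ for all $\rho>0$; 2. there is $h\in L^1([0,\infty))$ with $\rho\,\|V\,(H_0+1)^{-1}F(|\mathbf x|>\rho)\|\le h(\rho)$ for all $\rho>0$; 3. for every $g\in C_0^\infty(\mathbb R)$ there is $h_g\in L^1([0,\infty))$ with $\rho\,\|V\,g(H_0)\,F(|\mathbf x|>\rho)\|\le h_g(\rho)$ for all $\rho>0$. Then for every $\Phi\in\mathcal D_0$ there is a positive function $h\in L^1(\mathbb R)$ such that $$\|V_t\,e^{-itH_0}\Phi\|\le\frac{h(t)}{1+|t|}\qquad\text{for all }t\in\mathbb R,\tag{5}$$ and also a function $\widetilde h\in L^1([0,\infty))$ such that $|t|\,\|V_t\,e^{-itH_0}\Phi\|\le\widetilde h(|t|)$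 for all $t\in\mathbb R$. **(B)** Assume that the distributional azimuthal derivative $\partial_\phi V$ is an essentially bounded function, and that one of the following conditions holds: 1. there is $h\in L^1([0,\infty))$ with $\|\partial_\phi V\,F(|\mathbf x|>\rho)\|\le h(\rho)$ for all $\rho>0$; 2. there is $h\in L^1([0,\infty))$ with $\|\partial_\phi V\,(H_0+1)^{-1}F(|\mathbf x|>\rho)\|\le h(\rho)$ for all $\rho>0$; 3. for every $g\in C_0^\infty(\mathbb R)$ there is $h_g\in L^1([0,\infty))$ with $\|\partial_\phi V\,g(H_0)\,F(|\mathbf x|>\rho)\|\le h_g(\rho)$ for all $\rho>0$. Then the distributional time derivative $\partial_tV_t$ exists and is an essentially bounded function for every $t\in\mathbb R$ (that is, $\frac{d}{dt}\int V_t\,\eta\,d\mathbf x=\int(\partial_tV_t)\,\eta\,d\mathbf x$ for all $\eta\in C_0^\infty(\mathbb R^\nu)$). Moreover, for every $\Phi\in\mathcal D_0$ there is a positive function $h\in L^1(\mathbb R)$ such that $$\|\partial_tV_t\,e^{-itH_0}\Phi\|\le h(t)\qquad\text{for all }t\in\mathbb R,\tag{6}$$ and also a function $\widetilde h\in L^1([0,\infty))$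 such that $\|\partial_tV_t\,e^{-itH_0}\Phi\|\le\widetilde h(|t|)$ for all $t\in\mathbb R$. -/

import Mathlib

open MeasureTheory Set FourierTransform
open scoped ENNReal NNReal ContDiff

noncomputable section

namespace RotPot

/-- Configuration space (and momentum space) `ℝ^ν` with the Euclidean norm. -/
abbrev Space (ν : ℕ) : Type := EuclideanSpace ℝ (Fin ν)

/-- The Hilbert space `L²(ℝ^ν)` of complex wave functions. -/
abbrev Hilb (ν : ℕ) : Type := Lp (α := Space ν) ℂ 2 volume

/-- The momentum space wave function in the normalization
`φ̂(p) = (2π)^(-ν/2) ∫ exp(-i p⬝x) φ(x) dx`. Mathlib's unitary Fourier transform `𝓕` on `L²` has the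
kernel `exp(-2π i ξ⬝x)`, so that `p = 2π ξ`. -/
def momentumWF {ν : ℕ} (Ψ : Hilb ν) : Space ν → ℂ := fun p =>
  (((2 * Real.pi) ^ (-(ν : ℝ) / 2) : ℝ) : ℂ) * (𝓕 Ψ : Hilb ν) ((2 * Real.pi)⁻¹ • p)

/-- The kinetic energy `p²/2m` at momentum `p`. -/
def kineticEnergy {ν : ℕ} (m : ℝ) (p : Space ν) : ℝ := ‖p‖ ^ 2 / (2 * m)

/-- The function `ξ ↦ a(p²/2m) (𝓕 Ψ)(ξ)`, `p = 2π ξ`, which represents `a(H₀) Ψ` on the Fourier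
side. -/
def symbolMul {ν : ℕ} (m : ℝ) (a : ℝ → ℂ) (Ψ : Hilb ν) : Space ν → ℂ := fun ξ =>
  a (kineticEnergy m ((2 * Real.pi) • ξ)) * (𝓕 Ψ : Hilb ν) ξ

/-- `Ψ` belongs to the domain of the operator `a(H₀)`, where `H₀ = -Δ/2m`. -/
def InDomain {ν : ℕ} (m : ℝ) (a : ℝ → ℂ) (Ψ : Hilb ν) : Prop :=
  MemLp (symbolMul m a Ψ) 2 volume

open Classical in
/-- The vector `a(H₀) Ψ`, where `H₀ = -Δ/2m` is the self-adjoint free Hamiltonian, i.e.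
multiplication by `p²/2m` in momentum space (with the value `0` outside the domain of `a(H₀)`). -/
def funcH0 {ν : ℕ} (m : ℝ) (a : ℝ → ℂ) (Ψ : Hilb ν) : Hilb ν :=
  if h : InDomain m a Ψ then 𝓕⁻ (h.toLp (symbolMul m a Ψ) : Hilb ν) else 0

/-- If `a` is measurable and bounded on `[0, ∞)` then `a(H₀)` is everywhere defined. -/
theorem inDomain_of_bounded {ν : ℕ} {m : ℝ} (hm : 0 < m) {a : ℝ → ℂ} (ha : Measurable a) {C : ℝ}
    (hC : ∀ l : ℝ, 0 ≤ l → ‖a l‖ ≤ C) (Ψ : Hilb ν) : InDomain m a Ψ := by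
  have hk : Measurable fun ξ : Space ν => a (kineticEnergy m ((2 * Real.pi) • ξ)) := by
    apply ha.comp
    unfold kineticEnergy
    fun_prop
  refine MemLp.of_le_mul (c := C) (Lp.memLp (𝓕 Ψ : Hilb ν))
    (hk.aestronglyMeasurable.mul (Lp.aestronglyMeasurable _)) (Filter.Eventually.of_forall ?_)
  intro ξ
  unfold symbolMul
  rw [norm_mul]
  exact mul_le_mul_of_nonneg_right
    (hC _ (div_nonneg (sq_nonneg _) (by positivity))) (norm_nonneg _)

/-- The free Hamiltonian `H₀`, to be applied to vectors in its domain `InDomain m (fun l => l)`. -/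
def freeHam {ν : ℕ} (m : ℝ) : Hilb ν → Hilb ν := funcH0 m (fun l => (l : ℂ))

/-- The free time evolution `exp(-i t H₀)`. -/
def freeEvol {ν : ℕ} (m t : ℝ) : Hilb ν → Hilb ν :=
  funcH0 m (fun l => Complex.exp (-(Complex.I * t * l)))

/-- The resolvent `(H₀ + 1)⁻¹`. -/
def resolvent {ν : ℕ} (m : ℝ) : Hilb ν → Hilb ν := funcH0 m (fun l => ((l : ℂ) + 1)⁻¹)

/-- The operator `g(H₀)` for a real function `g`. -/
def cutH0 {ν : ℕ} (m : ℝ) (g : ℝ → ℝ) : Hilb ν → Hilb ν := funcH0 m (fun l => (g l : ℂ))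

/-- The operator `F(|x| > ρ)` of multiplication by the indicator function of `{x | |x| > ρ}`. -/
def cutSpace {ν : ℕ} (ρ : ℝ) (Ψ : Hilb ν) : Hilb ν :=
  ((Lp.memLp Ψ).indicator
    (measurableSet_lt measurable_const measurable_norm : MeasurableSet {x : Space ν | ρ < ‖x‖})).toLp
    _

/-- The `L²` norm of `V Ψ`, with the value `∞` if `V Ψ` is not square integrable. -/
def mulNorm {ν : ℕ} (V : Space ν → ℝ) (Ψ : Hilb ν) : ℝ≥0∞ :=
  eLpNorm (fun x => (V x : ℂ) * Ψ x) 2 volume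

/-- The operator norm `‖V A‖` of the multiplication operator `V` after the operator `A`, with the
value `∞` if `V A` is not a bounded everywhere defined operator. -/
def mulOpNorm {ν : ℕ} (V : Space ν → ℝ) (A : Hilb ν → Hilb ν) : ℝ≥0∞ :=
  ⨆ Ψ : Hilb ν, ⨆ _ : ‖Ψ‖ ≤ 1, mulNorm V (A Ψ)

/-- `V` is Kato-bounded with respect to `H₀`: there are `a < 1` and `b < ∞` such that
`‖V Ψ‖ ≤ a ‖H₀ Ψ‖ + b ‖Ψ‖` for all `Ψ` in the domain of `H₀`. -/
def KatoBounded {ν : ℕ} (m : ℝ) (V : Space ν → ℝ) : Prop :=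
  ∃ a b : ℝ≥0, a < 1 ∧ ∀ Ψ : Hilb ν, InDomain m (fun l => (l : ℂ)) Ψ →
    mulNorm V Ψ ≤ a * ‖freeHam m Ψ‖ₑ + b * ‖Ψ‖ₑ

/-- `w(ρ) ≤ h(ρ)`, `ρ > 0`, for some integrable function `h` on `[0, ∞)`. -/
def HasIntegrableBound (w : ℝ → ℝ≥0∞) : Prop :=
  ∃ h : ℝ → ℝ, IntegrableOn h (Ici 0) volume ∧ ∀ ρ : ℝ, 0 < ρ → w ρ ≤ ENNReal.ofReal (h ρ)

/-- Normalized states with a smooth momentum space wave function whose support is compact and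
contained in the open ball of radius `m|v|/3` around `m v`, for some velocity `v ≠ 0`. -/
def goodStates (ν : ℕ) (m : ℝ) : Set (Hilb ν) :=
  {Φ | ‖Φ‖ = 1 ∧ ∃ φ : Space ν → ℂ, momentumWF Φ =ᵐ[volume] φ ∧ ContDiff ℝ ∞ φ ∧
    HasCompactSupport φ ∧
    ∃ v : Space ν, v ≠ 0 ∧ tsupport φ ⊆ Metric.ball (m • v) (m * ‖v‖ / 3)}

/-- The coordinates of the point `x` rotated by the angle `θ` in the `x₁,x₂`-plane (the two first
coordinates have the indices `0` and `1`). -/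
def rotFun {d : ℕ} (θ : ℝ) (x : Space (d + 2)) : Space (d + 2) :=
  WithLp.toLp 2 fun k =>
    if k = 0 then Real.cos θ * x 0 - Real.sin θ * x 1
    else if k = 1 then Real.sin θ * x 0 + Real.cos θ * x 1
    else x k

theorem rotFun_neg_rotFun {d : ℕ} (θ : ℝ) (x : Space (d + 2)) : rotFun (-θ) (rotFun θ x) = x := by
  have h := Real.sin_sq_add_cos_sq θ
  ext k
  simp only [rotFun, Real.cos_neg, Real.sin_neg]
  by_cases h0 : k = 0
  · subst h0
    simp
    linear_combination x.ofLp 0 * h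
  · by_cases h1 : k = 1
    · subst h1
      simp
      linear_combination x.ofLp 1 * h
    · simp [h0, h1]

/-- The rotation `R(t)` by the angle `Ω t` in the `x₁,x₂`-plane. -/
def rot {d : ℕ} (Ω t : ℝ) : Space (d + 2) ≃ Space (d + 2) where
  toFun := rotFun (Ω * t)
  invFun := rotFun (-(Ω * t))
  left_inv := rotFun_neg_rotFun (Ω * t)
  right_inv x := by simpa using rotFun_neg_rotFun (-(Ω * t)) x

/-- The rotating potential `V_t(x) = V(R(t)⁻¹ x)`. -/
def rotPotential {d : ℕ} (Ω : ℝ) (V : Space (d + 2) → ℝ) (t : ℝ) : Space (d + 2) → ℝ :=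
  fun x => V ((rot Ω t).symm x)

/-- The vector field `∂_φ = x₁ ∂₂ - x₂ ∂₁`. -/
def azimuthalField {d : ℕ} (x : Space (d + 2)) : Space (d + 2) :=
  WithLp.toLp 2 fun k => if k = 0 then -x 1 else if k = 1 then x 0 else 0

/-- The locally integrable function `W` is the azimuthal derivative `∂_φ V` of the locally
integrable function `V` in the sense of distributions. -/
def IsAzimuthalDeriv {d : ℕ} (V W : Space (d + 2) → ℝ) : Prop :=
  LocallyIntegrable V volume ∧ LocallyIntegrable W volume ∧
  ∀ η : Space (d + 2) → ℝ, ContDiff ℝ ∞ η → HasCompactSupport η →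
    ∫ x, V x * fderiv ℝ η x (azimuthalField x) = -∫ x, W x * η x

/-- The locally integrable functions `Vdot t` are the time derivatives `∂_t V_t` of the locally
integrable functions `Vt t` in the sense of distributions on configuration space, for every
time `t`. -/
def IsTimeDeriv {ν : ℕ} (Vt Vdot : ℝ → Space ν → ℝ) : Prop :=
  (∀ t, LocallyIntegrable (Vt t) volume) ∧ (∀ t, LocallyIntegrable (Vdot t) volume) ∧
  ∀ η : Space ν → ℝ, ContDiff ℝ ∞ η → HasCompactSupport η →
    ∀ t : ℝ, HasDerivAt (fun s => ∫ x, Vt s x * η x) (∫ x, Vdot t x * η x) t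

end RotPot

end

/-! The momenta of `Φ` lie in a ball of radius `m|v|/3` around `mv`, so every velocity in the state
has component at least `2|v|/3 = 2s` along `v`. Hence the region `|x| ≤ s|t|` is classically
forbidden at time `t`, and there the wave function is `O(|t|⁻ᴺ)` for every `N`
(`norm_integral_cexp_phase_le`).

A Kato-bounded `V` may be unbounded on that region. Since the norm of `Vψ` depends monotonically on
`|ψ|`, the lagging part is dominated by a small constant times a dilated smooth cutoff. The Kato
bound on this cutoff grows only polynomially in `|t|` (`exists_mulNorm_scaled_le`), which rapid
decay absorbs. On `|x| > s|t|` the assumed decay at `ρ = s|t|` gives an integrable bound in `t`. For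
the conditions with `A = (H₀+1)⁻¹` or `g(H₀)`, write `Φ = AΦ'` and commute `A` with the evolution.
The lagging part is then small in norm, and `VA` is bounded.

Rotations commute with functions of `H₀` and with the cutoffs, so all estimates hold for `V_t` with
the constants of `V`. For (B), moving the rotation onto the test function shows `∂_t V_t = -Ω (∂_φ
V)_t`. A bounded function is Kato-bounded with `a = 0`, so the same estimate applies with weight
exponent `κ = 0` instead of `κ = 1`. -/

noncomputable section

namespace RotPot

open scoped InnerProductSpace

variable {ν : ℕ} {m : ℝ}

/-! ### Functions of the free Hamiltonian -/

/-- Composition of a wave function with a linear isometry of configuration space. -/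
def compL (L : Space ν ≃ₗᵢ[ℝ] Space ν) : Hilb ν →ₗᵢ[ℂ] Hilb ν :=
  Lp.compMeasurePreservingₗᵢ ℂ L L.measurePreserving

theorem coeFn_compL (L : Space ν ≃ₗᵢ[ℝ] Space ν) (Ψ : Hilb ν) :
    compL L Ψ =ᵐ[volume] Ψ ∘ L :=
  Lp.coeFn_compMeasurePreserving Ψ L.measurePreserving

theorem ae_comp {β : Type*} {f g : Space ν → β} (L : Space ν ≃ₗᵢ[ℝ] Space ν)
    (h : f =ᵐ[volume] g) : f ∘ L =ᵐ[volume] g ∘ L :=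
  L.measurePreserving.quasiMeasurePreserving.ae_eq_comp h

/-- Both sides are continuous in `Ψ`, so density reduces the claim to Schwartz functions, where it
is an orthogonal change of variables. -/
theorem fourier_compL (L : Space ν ≃ₗᵢ[ℝ] Space ν) (Ψ : Hilb ν) :
    (𝓕 (compL L Ψ) : Hilb ν) = compL L (𝓕 Ψ : Hilb ν) := by
  refine DenseRange.induction_on
    (p := fun Ψ : Hilb ν => (𝓕 (compL L Ψ) : Hilb ν) = compL L (𝓕 Ψ : Hilb ν))
    (SchwartzMap.denseRange_toLpCLM (F := ℂ) (p := 2) (μ := (volume : Measure (Space ν)))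
      ENNReal.ofNat_ne_top) Ψ ?_ ?_
  · have hF := (Lp.fourierTransformₗᵢ (Space ν) ℂ).continuous
    exact isClosed_eq (hF.comp (compL L).continuous) ((compL L).continuous.comp hF)
  · intro f
    have h1 : ∀ g : SchwartzMap (Space ν) ℂ, compL L (g.toLp 2 volume) =
        (SchwartzMap.compCLMOfContinuousLinearEquiv ℂ L.toContinuousLinearEquiv g).toLp 2
          volume := by
      intro g
      apply Lp.ext
      refine (coeFn_compL L _).trans ((ae_comp L (g.coeFn_toLp 2 volume)).trans ?_)
      exact (SchwartzMap.coeFn_toLp (SchwartzMap.compCLMOfContinuousLinearEquiv ℂ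
        L.toContinuousLinearEquiv g) 2 volume).symm
    rw [SchwartzMap.toLpCLM_apply, SchwartzMap.toLp_fourier_eq, h1, h1,
      SchwartzMap.toLp_fourier_eq]
    congr 1
    ext x
    rw [SchwartzMap.fourier_coe]
    change 𝓕 (f ∘ L) x = (𝓕 f) (L x)
    rw [SchwartzMap.fourier_coe, Real.fourier_comp_linearIsometry]

theorem kineticEnergy_nonneg (hm : 0 < m) (p : Space ν) : 0 ≤ kineticEnergy m p :=
  div_nonneg (sq_nonneg _) (by positivity)

theorem symbolMul_congr {a : ℝ → ℂ} {Ψ : Hilb ν} {f : Space ν → ℂ}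
    (h : (𝓕 Ψ : Hilb ν) =ᵐ[volume] f) :
    symbolMul m a Ψ =ᵐ[volume] fun ξ => a (kineticEnergy m ((2 * Real.pi) • ξ)) * f ξ := by
  filter_upwards [h] with ξ hξ
  rw [symbolMul, hξ]

theorem funcH0_of_inDomain {a : ℝ → ℂ} {Ψ : Hilb ν} (h : InDomain m a Ψ) :
    funcH0 m a Ψ = 𝓕⁻ (h.toLp (symbolMul m a Ψ) : Hilb ν) := by
  rw [funcH0, dif_pos h]

theorem fourier_funcH0_eq_toLp {a : ℝ → ℂ} {Ψ : Hilb ν} (h : InDomain m a Ψ) :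
    (𝓕 (funcH0 m a Ψ) : Hilb ν) = h.toLp (symbolMul m a Ψ) := by
  rw [funcH0_of_inDomain h, FourierTransform.fourier_fourierInv_eq]

theorem fourier_funcH0 {a : ℝ → ℂ} {Ψ : Hilb ν} (h : InDomain m a Ψ) :
    (𝓕 (funcH0 m a Ψ) : Hilb ν) =ᵐ[volume] symbolMul m a Ψ := by
  rw [fourier_funcH0_eq_toLp h]
  exact h.coeFn_toLp

theorem enorm_fourier (Ψ : Hilb ν) : ‖(𝓕 Ψ : Hilb ν)‖ₑ = ‖Ψ‖ₑ := by
  rw [← ofReal_norm, Lp.norm_fourier_eq, ofReal_norm]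

theorem enorm_funcH0 {a : ℝ → ℂ} {Ψ : Hilb ν} (h : InDomain m a Ψ) :
    ‖funcH0 m a Ψ‖ₑ = eLpNorm (symbolMul m a Ψ) 2 volume := by
  rw [← enorm_fourier, fourier_funcH0_eq_toLp h, Lp.enorm_def]
  exact eLpNorm_congr_ae h.coeFn_toLp

theorem eq_of_fourier_ae_eq {Ψ Φ : Hilb ν}
    (h : (𝓕 Ψ : Hilb ν) =ᵐ[volume] (𝓕 Φ : Hilb ν)) : Ψ = Φ := by
  have := Lp.ext h
  exact (Lp.fourierTransformₗᵢ (Space ν) ℂ).injective this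

/-- The energy depends only on the length of the momentum. This is why functions of `H₀` commute
with rotations. -/
theorem symbolMul_compL (L : Space ν ≃ₗᵢ[ℝ] Space ν) (a : ℝ → ℂ) (Ψ : Hilb ν) :
    symbolMul m a (compL L Ψ) =ᵐ[volume] symbolMul m a Ψ ∘ L := by
  have h : (𝓕 (compL L Ψ) : Hilb ν) =ᵐ[volume] (𝓕 Ψ : Hilb ν) ∘ L := by
    rw [fourier_compL]
    exact coeFn_compL L _
  filter_upwards [h] with ξ hξ
  simp only [symbolMul, hξ, Function.comp, kineticEnergy, norm_smul, L.norm_map]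

theorem InDomain.compL {a : ℝ → ℂ} {Ψ : Hilb ν} (h : InDomain m a Ψ)
    (L : Space ν ≃ₗᵢ[ℝ] Space ν) : InDomain m a (compL L Ψ) :=
  (memLp_congr_ae (symbolMul_compL L a Ψ)).2 (h.comp_measurePreserving L.measurePreserving)

theorem funcH0_compL {a : ℝ → ℂ} {Ψ : Hilb ν} (h : InDomain m a Ψ)
    (L : Space ν ≃ₗᵢ[ℝ] Space ν) : funcH0 m a (compL L Ψ) = compL L (funcH0 m a Ψ) := by
  apply eq_of_fourier_ae_eq
  rw [fourier_compL]
  refine (fourier_funcH0 (h.compL L)).trans ((symbolMul_compL L a Ψ).trans ?_)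
  exact ((coeFn_compL L _).trans (ae_comp L (fourier_funcH0 h))).symm

theorem coeFn_fourier_add (Ψ Φ : Hilb ν) :
    (𝓕 (Ψ + Φ) : Hilb ν) =ᵐ[volume] (𝓕 Ψ : Hilb ν) + (𝓕 Φ : Hilb ν) := by
  rw [FourierTransform.fourier_add]
  exact Lp.coeFn_add _ _

theorem coeFn_fourier_smul (c : ℂ) (Ψ : Hilb ν) :
    (𝓕 (c • Ψ) : Hilb ν) =ᵐ[volume] c • (𝓕 Ψ : Hilb ν) := by
  rw [FourierTransform.fourier_smul]
  exact Lp.coeFn_smul _ _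

/-- `a(H₀)` as a linear map, for an everywhere defined operator. -/
def funcH0ₗ (m : ℝ) (a : ℝ → ℂ) (h : ∀ Ψ : Hilb ν, InDomain m a Ψ) : Hilb ν →ₗ[ℂ] Hilb ν where
  toFun := funcH0 m a
  map_add' Ψ Φ := by
    apply eq_of_fourier_ae_eq
    filter_upwards [fourier_funcH0 (h (Ψ + Φ)), coeFn_fourier_add Ψ Φ,
      coeFn_fourier_add (funcH0 m a Ψ) (funcH0 m a Φ), fourier_funcH0 (h Ψ),
      fourier_funcH0 (h Φ)] with ξ h1 h2 h3 h4 h5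
    rw [h1, h3, symbolMul, h2, Pi.add_apply, Pi.add_apply, h4, h5, symbolMul, symbolMul, mul_add]
  map_smul' c Ψ := by
    apply eq_of_fourier_ae_eq
    filter_upwards [fourier_funcH0 (h (c • Ψ)), coeFn_fourier_smul c Ψ,
      coeFn_fourier_smul c (funcH0 m a Ψ), fourier_funcH0 (h Ψ)] with ξ h1 h2 h3 h4
    rw [h1, RingHom.id_apply, h3, symbolMul, h2, Pi.smul_apply, Pi.smul_apply, h4, symbolMul,
      smul_eq_mul, smul_eq_mul]
    ring

theorem enorm_funcH0_le (hm : 0 < m) {a : ℝ → ℂ} {Ψ : Hilb ν} (h : InDomain m a Ψ) {C : ℝ≥0}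
    (hC : ∀ l : ℝ, 0 ≤ l → ‖a l‖ ≤ C) : ‖funcH0 m a Ψ‖ₑ ≤ C * ‖Ψ‖ₑ := by
  rw [enorm_funcH0 h, ← enorm_fourier Ψ, Lp.enorm_def]
  refine eLpNorm_le_nnreal_smul_eLpNorm_of_ae_le_mul (Filter.Eventually.of_forall fun ξ => ?_) 2
  rw [symbolMul, nnnorm_mul]
  refine mul_le_mul_left ?_ _
  exact hC _ (kineticEnergy_nonneg hm _)

theorem enorm_freeEvol_le (hm : 0 < m) (t : ℝ) (Ψ : Hilb ν) : ‖freeEvol m t Ψ‖ₑ ≤ ‖Ψ‖ₑ := by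
  have hb : ∀ l : ℝ, 0 ≤ l → ‖Complex.exp (-(Complex.I * t * l))‖ ≤ ((1 : ℝ≥0) : ℝ) := by
    intro l _
    rw [show -(Complex.I * t * l) = ((-(t * l) : ℝ) : ℂ) * Complex.I by push_cast; ring,
      Complex.norm_exp_ofReal_mul_I, NNReal.coe_one]
  have := enorm_funcH0_le hm
    (inDomain_of_bounded hm (a := fun l : ℝ => Complex.exp (-(Complex.I * t * l)))
      (by fun_prop) hb Ψ) hb
  simpa [freeEvol] using this

theorem inDomain_freeEvol (hm : 0 < m) (t : ℝ) (Ψ : Hilb ν) :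
    InDomain m (fun l => Complex.exp (-(Complex.I * t * l))) Ψ := by
  refine inDomain_of_bounded hm (C := 1) (by fun_prop) (fun l _ => ?_) Ψ
  rw [show -(Complex.I * t * l) = ((-(t * l) : ℝ) : ℂ) * Complex.I by push_cast; ring,
    Complex.norm_exp_ofReal_mul_I]

/-- The hypothesis on `Φ` says `Φ = a(H₀)Φ'`; functions of `H₀` commute because their symbols do. -/
theorem funcH0_freeEvol (hm : 0 < m) {a : ℝ → ℂ} (h : ∀ Ψ : Hilb ν, InDomain m a Ψ)
    {Φ Φ' : Hilb ν} (hΦ : (𝓕 Φ : Hilb ν) =ᵐ[volume] symbolMul m a Φ') (t : ℝ) :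
    funcH0 m a (freeEvol m t Φ') = freeEvol m t Φ := by
  apply eq_of_fourier_ae_eq
  filter_upwards [fourier_funcH0 (h (freeEvol m t Φ')), fourier_funcH0 (inDomain_freeEvol hm t Φ),
    fourier_funcH0 (inDomain_freeEvol hm t Φ'), hΦ] with ξ h1 h2 h3 h4
  unfold freeEvol at h1 ⊢
  rw [h1, h2, symbolMul, h3, symbolMul, symbolMul, h4, symbolMul]
  ring

/-! ### Multiplication by potentials -/

/-- Kato-boundedness with explicit constants. -/
def KatoWith (m : ℝ) (a b : ℝ≥0) (U : Space ν → ℝ) : Prop :=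
  ∀ Ψ : Hilb ν, InDomain m (fun l => (l : ℂ)) Ψ →
    mulNorm U Ψ ≤ a * ‖freeHam m Ψ‖ₑ + b * ‖Ψ‖ₑ

theorem aestronglyMeasurable_mul {U : Space ν → ℝ} (hU : AEMeasurable U volume) (Ψ : Hilb ν) :
    AEStronglyMeasurable (fun x => (U x : ℂ) * Ψ x) volume :=
  (Complex.measurable_ofReal.comp_aemeasurable hU).aestronglyMeasurable.mul
    (Lp.aestronglyMeasurable Ψ)

theorem mulNorm_add_le {U : Space ν → ℝ} (hU : AEMeasurable U volume) (Ψ Φ : Hilb ν) :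
    mulNorm U (Ψ + Φ) ≤ mulNorm U Ψ + mulNorm U Φ := by
  refine le_trans (le_of_eq ?_)
    (eLpNorm_add_le (aestronglyMeasurable_mul hU Ψ) (aestronglyMeasurable_mul hU Φ) one_le_two)
  refine eLpNorm_congr_ae ?_
  filter_upwards [Lp.coeFn_add Ψ Φ] with x hx
  rw [hx, Pi.add_apply, Pi.add_apply, mul_add]

theorem mulNorm_smul (U : Space ν → ℝ) (c : ℂ) (Ψ : Hilb ν) :
    mulNorm U (c • Ψ) = ‖c‖ₑ * mulNorm U Ψ := by
  rw [mulNorm, mulNorm, ← eLpNorm_const_smul]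
  refine eLpNorm_congr_ae ?_
  filter_upwards [Lp.coeFn_smul c Ψ] with x hx
  rw [hx, Pi.smul_apply, Pi.smul_apply, smul_eq_mul, smul_eq_mul]
  ring

theorem mulNorm_const_mul (U : Space ν → ℝ) (c : ℝ) (Ψ : Hilb ν) :
    mulNorm (fun x => c * U x) Ψ = ‖c‖ₑ * mulNorm U Ψ := by
  rw [mulNorm, mulNorm, ← eLpNorm_const_smul]
  congr 1
  ext x
  simp [mul_assoc]

theorem mulOpNorm_const_mul (U : Space ν → ℝ) (c : ℝ) (A : Hilb ν → Hilb ν) :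
    mulOpNorm (fun x => c * U x) A = ‖c‖ₑ * mulOpNorm U A := by
  simp only [mulOpNorm, mulNorm_const_mul, ENNReal.mul_iSup]

theorem mulNorm_le_mulOpNorm_mul (U : Space ν → ℝ) (A : Hilb ν →ₗ[ℂ] Hilb ν) (Ψ : Hilb ν) :
    mulNorm U (A Ψ) ≤ mulOpNorm U A * ‖Ψ‖ₑ := by
  by_cases h0 : Ψ = 0
  · subst h0
    have : mulNorm U (0 : Hilb ν) = 0 := by
      have := mulNorm_smul U 0 (0 : Hilb ν)
      simpa using this
    simp [this]
  · have hn : ‖Ψ‖ ≠ 0 := norm_ne_zero_iff.2 h0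
    have h1 : Ψ = ((‖Ψ‖ : ℝ) : ℂ) • (((‖Ψ‖⁻¹ : ℝ) : ℂ) • Ψ) := by
      rw [smul_smul, ← Complex.ofReal_mul, mul_inv_cancel₀ hn, Complex.ofReal_one, one_smul]
    have h2 : ‖((‖Ψ‖⁻¹ : ℝ) : ℂ) • Ψ‖ ≤ 1 := by
      rw [norm_smul, Complex.norm_real, norm_inv, norm_norm, inv_mul_cancel₀ hn]
    have h3 : ‖((‖Ψ‖ : ℝ) : ℂ)‖ₑ = ‖Ψ‖ₑ := by
      rw [← ofReal_norm, Complex.norm_real, norm_norm, ofReal_norm]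
    conv_lhs => rw [h1, map_smul, mulNorm_smul, h3, mul_comm]
    refine mul_le_mul_left ?_ _
    exact le_iSup₂ (f := fun (Φ : Hilb ν) (_ : ‖Φ‖ ≤ 1) => mulNorm U (A Φ)) _ h2

/-- Transfers a rotation from the potential to the state, where it can be commuted with functions of
`H₀` and with cutoffs. -/
theorem mulNorm_comp_symm {U : Space ν → ℝ} (hU : AEMeasurable U volume)
    (L : Space ν ≃ₗᵢ[ℝ] Space ν) (Ψ : Hilb ν) :
    mulNorm (fun x => U (L.symm x)) Ψ = mulNorm U (compL L Ψ) := by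
  have h : AEMeasurable (fun x => U (L.symm x)) volume :=
    hU.comp_quasiMeasurePreserving L.symm.measurePreserving.quasiMeasurePreserving
  rw [mulNorm, mulNorm, ← eLpNorm_comp_measurePreserving (aestronglyMeasurable_mul h Ψ)
    L.measurePreserving]
  refine eLpNorm_congr_ae ?_
  filter_upwards [coeFn_compL L Ψ] with x hx
  simp [hx]

theorem KatoWith.comp_symm {a b : ℝ≥0} {U : Space ν → ℝ} (hU : AEMeasurable U volume)
    (hK : KatoWith m a b U) (L : Space ν ≃ₗᵢ[ℝ] Space ν) :
    KatoWith m a b (fun x => U (L.symm x)) := by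
  intro Ψ hΨ
  rw [mulNorm_comp_symm hU]
  refine (hK _ (hΨ.compL L)).trans ?_
  unfold freeHam
  rw [funcH0_compL hΨ, LinearIsometry.enorm_map, LinearIsometry.enorm_map]

theorem mulOpNorm_comp_symm_le {U : Space ν → ℝ} (hU : AEMeasurable U volume)
    (L : Space ν ≃ₗᵢ[ℝ] Space ν) {A : Hilb ν → Hilb ν}
    (hA : ∀ Ψ, A (compL L Ψ) = compL L (A Ψ)) :
    mulOpNorm (fun x => U (L.symm x)) A ≤ mulOpNorm U A := by
  refine iSup₂_le fun Ψ hΨ => ?_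
  rw [mulNorm_comp_symm hU, ← hA]
  exact le_iSup₂ (f := fun (Φ : Hilb ν) (_ : ‖Φ‖ ≤ 1) => mulNorm U (A Φ)) (compL L Ψ)
    (by rwa [LinearIsometry.norm_map])

/-- Boundedness of `l * c l` means that `c(H₀)` maps into the domain of `H₀`, so the Kato bound
makes `U c(H₀)` a bounded operator. -/
theorem KatoWith.mulNorm_funcH0_le (hm : 0 < m) {a b : ℝ≥0} {U : Space ν → ℝ}
    (hK : KatoWith m a b U) {c : ℝ → ℂ} (hc : Measurable c) {C₀ C₁ : ℝ≥0}
    (h0 : ∀ l : ℝ, 0 ≤ l → ‖c l‖ ≤ C₀) (h1 : ∀ l : ℝ, 0 ≤ l → ‖(l : ℂ) * c l‖ ≤ C₁)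
    (Ψ : Hilb ν) : mulNorm U (funcH0 m c Ψ) ≤ (a * C₁ + b * C₀ : ℝ≥0) * ‖Ψ‖ₑ := by
  have d0 := inDomain_of_bounded hm hc h0 Ψ
  have d1 := inDomain_of_bounded hm (a := fun l : ℝ => (l : ℂ) * c l) (by fun_prop) h1 Ψ
  have e : symbolMul m (fun l => (l : ℂ)) (funcH0 m c Ψ) =ᵐ[volume]
      symbolMul m (fun l : ℝ => (l : ℂ) * c l) Ψ := by
    filter_upwards [fourier_funcH0 d0] with ξ hξ
    rw [symbolMul, hξ, symbolMul, symbolMul, mul_assoc]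
  have d2 : InDomain m (fun l => (l : ℂ)) (funcH0 m c Ψ) := (memLp_congr_ae e).2 d1
  have e2 : ‖freeHam m (funcH0 m c Ψ)‖ₑ = ‖funcH0 m (fun l : ℝ => (l : ℂ) * c l) Ψ‖ₑ := by
    rw [freeHam, enorm_funcH0 d2, enorm_funcH0 d1, eLpNorm_congr_ae e]
  refine (hK _ d2).trans ?_
  rw [e2]
  push_cast
  rw [add_mul, mul_assoc, mul_assoc]
  gcongr
  · exact enorm_funcH0_le hm d1 h1
  · exact enorm_funcH0_le hm d0 h0

theorem katoWith_of_bounded {W : Space ν → ℝ} {C : ℝ≥0}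
    (hW : ∀ᵐ x, ‖W x‖ ≤ C) : KatoWith m 0 C W := by
  intro Ψ _
  rw [ENNReal.coe_zero, zero_mul, zero_add, Lp.enorm_def]
  refine eLpNorm_le_nnreal_smul_eLpNorm_of_ae_le_mul ?_ 2
  filter_upwards [hW] with x hx
  rw [nnnorm_mul]
  refine mul_le_mul_left ?_ _
  rw [← NNReal.coe_le_coe, coe_nnnorm, Complex.norm_real]
  exact hx

/-! ### Spatial cutoffs -/

theorem coeFn_cutSpace (ρ : ℝ) (Ψ : Hilb ν) :
    cutSpace ρ Ψ =ᵐ[volume] {x : Space ν | ρ < ‖x‖}.indicator Ψ :=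
  MemLp.coeFn_toLp _

/-- The cutoff `F(|x| > ρ)` as a linear map. -/
def cutSpaceₗ (ρ : ℝ) : Hilb ν →ₗ[ℂ] Hilb ν where
  toFun := cutSpace ρ
  map_add' Ψ Φ := by
    apply Lp.ext
    filter_upwards [coeFn_cutSpace ρ (Ψ + Φ), coeFn_cutSpace ρ Ψ, coeFn_cutSpace ρ Φ,
      Lp.coeFn_add Ψ Φ, Lp.coeFn_add (cutSpace ρ Ψ) (cutSpace ρ Φ)] with x h1 h2 h3 h4 h5
    rw [h1, h5, Pi.add_apply, h2, h3]
    by_cases hx : x ∈ {x : Space ν | ρ < ‖x‖}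
    · simp only [indicator_of_mem hx, h4, Pi.add_apply]
    · simp only [indicator_of_notMem hx, add_zero]
  map_smul' c Ψ := by
    apply Lp.ext
    filter_upwards [coeFn_cutSpace ρ (c • Ψ), coeFn_cutSpace ρ Ψ,
      Lp.coeFn_smul c Ψ, Lp.coeFn_smul c (cutSpace ρ Ψ)] with x h1 h2 h3 h4
    rw [h1, RingHom.id_apply, h4, Pi.smul_apply, h2]
    by_cases hx : x ∈ {x : Space ν | ρ < ‖x‖}
    · simp only [indicator_of_mem hx, h3, Pi.smul_apply]
    · simp only [indicator_of_notMem hx, smul_zero]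

theorem cutSpace_compL (L : Space ν ≃ₗᵢ[ℝ] Space ν) (ρ : ℝ) (Ψ : Hilb ν) :
    cutSpace ρ (compL L Ψ) = compL L (cutSpace ρ Ψ) := by
  apply Lp.ext
  filter_upwards [coeFn_cutSpace ρ (compL L Ψ), coeFn_compL L Ψ, coeFn_compL L (cutSpace ρ Ψ),
    ae_comp L (coeFn_cutSpace ρ Ψ)] with x h1 h2 h3 h4
  rw [h1, h3, h4]
  simp only [indicator, mem_ofPred_eq, Function.comp, L.norm_map, h2]

theorem coeFn_sub_cutSpace (ρ : ℝ) (Ψ : Hilb ν) :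
    (Ψ - cutSpace ρ Ψ : Hilb ν) =ᵐ[volume] {x : Space ν | ‖x‖ ≤ ρ}.indicator Ψ := by
  filter_upwards [Lp.coeFn_sub Ψ (cutSpace ρ Ψ), coeFn_cutSpace ρ Ψ] with x h1 h2
  rw [h1, Pi.sub_apply, h2]
  by_cases hx : ρ < ‖x‖
  · simp [indicator, hx, not_le.2 hx]
  · simp [indicator, hx, not_lt.1 hx]

/-! ### Decay outside the classically allowed region -/

/-- The phase of the free evolution. -/
def phase (m t : ℝ) (x ξ : Space ν) : ℝ :=
  2 * Real.pi * ⟪ξ, x⟫_ℝ - t * kineticEnergy m ((2 * Real.pi) • ξ)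

/-- The derivative of the phase in the direction `e`. -/
def dphase (m t : ℝ) (e x ξ : Space ν) : ℝ :=
  2 * Real.pi * (⟪e, x⟫_ℝ - t * (2 * Real.pi / m * ⟪ξ, e⟫_ℝ))

theorem contDiff_phase (t : ℝ) (x : Space ν) : ContDiff ℝ ∞ (phase m t x) := by
  unfold phase kineticEnergy
  have h : ContDiff ℝ ∞ fun ξ : Space ν => ‖(2 * Real.pi) • ξ‖ ^ 2 :=
    (contDiff_const_smul _).norm_sq ℝ
  have h2 : ContDiff ℝ ∞ fun ξ : Space ν => ⟪ξ, x⟫_ℝ := contDiff_id.inner ℝ contDiff_const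
  exact (contDiff_const.mul h2).sub (contDiff_const.mul (h.div_const _))

theorem continuous_dphase (t : ℝ) (e x : Space ν) : Continuous (dphase m t e x) := by
  unfold dphase
  fun_prop

theorem hasLineDerivAt_phase (t : ℝ) (e x ξ : Space ν) :
    HasLineDerivAt ℝ (phase m t x) (dphase m t e x ξ) ξ e := by
  have h1 : (fun s : ℝ => phase m t x (ξ + s • e)) = fun s =>
      2 * Real.pi * (⟪ξ, x⟫_ℝ + s * ⟪e, x⟫_ℝ) -
        t * ((2 * Real.pi) ^ 2 * (‖ξ‖ ^ 2 + 2 * (s * ⟪ξ, e⟫_ℝ) + s ^ 2 * ‖e‖ ^ 2) / (2 * m)) := by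
    ext s
    rw [phase, kineticEnergy, norm_smul, mul_pow ‖2 * Real.pi‖, Real.norm_eq_abs, sq_abs,
      norm_add_sq_real, inner_add_left, real_inner_smul_left, real_inner_smul_right, norm_smul s,
      mul_pow ‖s‖, Real.norm_eq_abs s, sq_abs]
  rw [HasLineDerivAt, h1]
  have hs := hasDerivAt_id (0 : ℝ)
  have h2 := (((hs.mul_const ⟪e, x⟫_ℝ).const_add ⟪ξ, x⟫_ℝ).const_mul (2 * Real.pi)).sub
    ((((((hs.mul_const ⟪ξ, e⟫_ℝ).const_mul 2).const_add (‖ξ‖ ^ 2)).add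
      ((hs.pow 2).mul_const (‖e‖ ^ 2))).const_mul ((2 * Real.pi) ^ 2)).div_const (2 * m)
        |>.const_mul t)
  convert! h2 using 1
  simp only [dphase, id]
  -- For `m = 0` division by zero gives `0`, so the kinetic term disappears on both sides.
  by_cases hm : m = 0
  · subst hm; simp
  · field_simp
    ring

theorem hasLineDerivAt_dphase (t : ℝ) (e x ξ : Space ν) :
    HasLineDerivAt ℝ (dphase m t e x) (-(t * ((2 * Real.pi) ^ 2 / m * ‖e‖ ^ 2))) ξ e := by
  have h1 : (fun s : ℝ => dphase m t e x (ξ + s • e)) = fun s =>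
      2 * Real.pi * (⟪e, x⟫_ℝ - t * (2 * Real.pi / m * (⟪ξ, e⟫_ℝ + s * ‖e‖ ^ 2))) := by
    ext s
    rw [dphase, inner_add_left, real_inner_smul_left, real_inner_self_eq_norm_sq]
  rw [HasLineDerivAt, h1]
  have hs := hasDerivAt_id (0 : ℝ)
  have h2 := (((((hs.mul_const (‖e‖ ^ 2)).const_add ⟪ξ, e⟫_ℝ).const_mul
    (2 * Real.pi / m)).const_mul t).const_sub ⟪e, x⟫_ℝ).const_mul (2 * Real.pi)
  convert! h2 using 1
  ring

theorem hasLineDerivAt_cexp_phase (t : ℝ) (e x ξ : Space ν) :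
    HasLineDerivAt ℝ (fun ξ => Complex.exp (phase m t x ξ * Complex.I))
      (Complex.I * dphase m t e x ξ * Complex.exp (phase m t x ξ * Complex.I)) ξ e := by
  have h := ((hasLineDerivAt_phase (m := m) t e x ξ).ofReal_comp.mul_const Complex.I).cexp
  simp only [zero_smul, add_zero] at h
  rw [HasLineDerivAt]
  convert! h using 1
  ring

/-- The momenta, in the normalization of `𝓕`, with velocity component at least `2s` along `e`. -/
def fastSet (m s : ℝ) (e : Space ν) : Set (Space ν) := {ξ | 2 * s ≤ 2 * Real.pi / m * ⟪ξ, e⟫_ℝ}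

/-- The kinetic part of the directional derivative is at least `2s|t|` and the position part at most
`s|t|`, up to the common factor `2π`. So the phase is not stationary in the forbidden region. -/
theorem le_abs_dphase {s t : ℝ} {e x ξ : Space ν} (he : ‖e‖ ≤ 1)
    (hξ : ξ ∈ fastSet m s e) (hx : ‖x‖ ≤ s * |t|) : 2 * Real.pi * s * |t| ≤ |dphase m t e x ξ| := by
  have h1 : |⟪e, x⟫_ℝ| ≤ s * |t| :=
    (abs_real_inner_le_norm e x).trans
      ((mul_le_of_le_one_left (norm_nonneg _) he).trans hx)
  have h2 : |t| * (2 * s) ≤ |t * (2 * Real.pi / m * ⟪ξ, e⟫_ℝ)| := by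
    rw [abs_mul]
    exact mul_le_mul_of_nonneg_left (hξ.trans (le_abs_self _)) (abs_nonneg _)
  have h3 := abs_sub_abs_le_abs_sub (t * (2 * Real.pi / m * ⟪ξ, e⟫_ℝ)) ⟪e, x⟫_ℝ
  rw [dphase, abs_mul, abs_of_pos Real.two_pi_pos, mul_assoc]
  rw [abs_sub_comm] at h3
  exact mul_le_mul_of_nonneg_left (by linarith) Real.two_pi_pos.le

theorem hasLineDerivAt_zero_of_notMem_tsupport {f : Space ν → ℂ} {ξ e : Space ν}
    (h : ξ ∉ tsupport f) : HasLineDerivAt ℝ f 0 ξ e := by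
  have h0 := notMem_tsupport_iff_eventuallyEq.1 h
  exact ((hasFDerivAt_const (0 : ℂ) ξ).congr_of_eventuallyEq h0).hasLineDerivAt e

section

variable {f : Space ν → ℂ} {s t : ℝ} {e x : Space ν}

/-- Zeros of `dphase` are harmless: they lie off the support of `f`. -/
theorem continuous_mul_inv_dphase_pow (hs : 0 < s) (he : ‖e‖ ≤ 1) (hf : Continuous f)
    (hK : tsupport f ⊆ fastSet m s e) (ht : t ≠ 0) (hx : ‖x‖ ≤ s * |t|) (j : ℕ) :
    Continuous fun ξ => f ξ * (((dphase m t e x ξ)⁻¹ ^ j : ℝ) : ℂ) := by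
  refine continuous_of_tsupport fun ξ hξ => ?_
  have h1 := le_abs_dphase he (hK (tsupport_mul_subset_left hξ)) hx
  have h2 : 0 < 2 * Real.pi * s * |t| := by positivity
  have h3 : dphase m t e x ξ ≠ 0 := abs_pos.1 (h2.trans_le h1)
  exact hf.continuousAt.mul (Complex.continuous_ofReal.continuousAt.comp
    (((continuous_dphase t e x).continuousAt.inv₀ h3).pow j))

theorem hasLineDerivAt_mul_inv_dphase_pow (hs : 0 < s) (he : ‖e‖ ≤ 1) (hf : ContDiff ℝ ∞ f)
    (hK : tsupport f ⊆ fastSet m s e) (ht : t ≠ 0) (hx : ‖x‖ ≤ s * |t|) (j : ℕ) (ξ : Space ν) :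
    HasLineDerivAt ℝ (fun ξ => f ξ * (((dphase m t e x ξ)⁻¹ ^ (j + 1) : ℝ) : ℂ))
      (fderiv ℝ f ξ e * (((dphase m t e x ξ)⁻¹ ^ (j + 1) : ℝ) : ℂ) +
        ((j + 1) * (t * ((2 * Real.pi) ^ 2 / m * ‖e‖ ^ 2)) : ℝ) *
          (f ξ * (((dphase m t e x ξ)⁻¹ ^ (j + 2) : ℝ) : ℂ))) ξ e := by
  by_cases hξ : ξ ∈ tsupport f
  · have h1 := le_abs_dphase he (hK hξ) hx
    have h2 : 0 < 2 * Real.pi * s * |t| := by positivity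
    have h3 : dphase m t e x ξ ≠ 0 := abs_pos.1 (h2.trans_le h1)
    have hf' := ((hf.differentiable (by simp)) ξ).hasFDerivAt.hasLineDerivAt e
    have hd := hasLineDerivAt_dphase (m := m) t e x ξ
    rw [HasLineDerivAt] at hd hf'
    have hi := ((hd.inv (by simpa using h3)).pow (j + 1)).ofReal_comp
    rw [HasLineDerivAt]
    convert! hf'.mul hi using 1
    simp only [zero_smul, add_zero, Pi.inv_apply, Pi.pow_apply, Nat.add_sub_cancel]
    push_cast
    field_simp
    ring
  · have h1 : ξ ∉ tsupport (fun ξ => f ξ * (((dphase m t e x ξ)⁻¹ ^ (j + 1) : ℝ) : ℂ)) :=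
      fun h => hξ (tsupport_mul_subset_left h)
    have h2 : fderiv ℝ f ξ = 0 :=
      image_eq_zero_of_notMem_tsupport fun h => hξ (tsupport_fderiv_subset ℝ h)
    have h3 : f ξ = 0 := image_eq_zero_of_notMem_tsupport hξ
    simpa [h2, h3] using hasLineDerivAt_zero_of_notMem_tsupport (e := e) h1

theorem integrable_cexp_phase_mul {g : Space ν → ℂ} (hg : Continuous g) (hgc : HasCompactSupport g)
    (t : ℝ) (x : Space ν) :
    Integrable (fun ξ => Complex.exp (phase m t x ξ * Complex.I) * g ξ) := by
  have hp := (contDiff_phase (m := m) t x).continuous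
  refine Continuous.integrable_of_hasCompactSupport (by fun_prop) ?_
  exact hgc.mul_left

/-- One integration by parts along `e`, writing the exponential as `(i dphase)⁻¹` times its own
derivative. The phase is quadratic, so differentiating a power of `dphase⁻¹` only raises the power
and produces a factor constant in `ξ` and linear in `t`; the family of integrals is closed under the
step. -/
theorem integral_cexp_phase_eq (hs : 0 < s) (he : ‖e‖ ≤ 1) (hf : ContDiff ℝ ∞ f)
    (hfc : HasCompactSupport f) (hK : tsupport f ⊆ fastSet m s e) (ht : t ≠ 0)
    (hx : ‖x‖ ≤ s * |t|) (j : ℕ) :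
    ∫ ξ, Complex.exp (phase m t x ξ * Complex.I) * (f ξ * (((dphase m t e x ξ)⁻¹ ^ j : ℝ) : ℂ)) =
      Complex.I * ((∫ ξ, Complex.exp (phase m t x ξ * Complex.I) *
          (fderiv ℝ f ξ e * (((dphase m t e x ξ)⁻¹ ^ (j + 1) : ℝ) : ℂ))) +
        ((j + 1) * (t * ((2 * Real.pi) ^ 2 / m * ‖e‖ ^ 2)) : ℝ) *
          ∫ ξ, Complex.exp (phase m t x ξ * Complex.I) *
            (f ξ * (((dphase m t e x ξ)⁻¹ ^ (j + 2) : ℝ) : ℂ))) := by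
  have hfc' : HasCompactSupport fun ξ => fderiv ℝ f ξ e := hfc.fderiv_apply ℝ e
  have hf' : Continuous fun ξ => fderiv ℝ f ξ e :=
    (hf.continuous_fderiv (by simp)).clm_apply continuous_const
  have hK' : tsupport (fun ξ => fderiv ℝ f ξ e) ⊆ fastSet m s e :=
    (tsupport_fderiv_apply_subset ℝ e).trans hK
  have c1 := continuous_mul_inv_dphase_pow (m := m) hs he hf' hK' ht hx (j + 1)
  have c2 := continuous_mul_inv_dphase_pow hs he hf.continuous hK ht hx (j + 2)
  have c3 := continuous_mul_inv_dphase_pow hs he hf.continuous hK ht hx (j + 1)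
  have c4 := continuous_mul_inv_dphase_pow hs he hf.continuous hK ht hx j
  have i1 := integrable_cexp_phase_mul (m := m) c1 hfc'.mul_right t x
  have i2 := integrable_cexp_phase_mul (m := m) c2 hfc.mul_right t x
  have i3 := integrable_cexp_phase_mul (m := m) c3 hfc.mul_right t x
  have i4 := integrable_cexp_phase_mul (m := m) c4 hfc.mul_right t x
  have key : ∀ ξ, Complex.I * dphase m t e x ξ * Complex.exp (phase m t x ξ * Complex.I) *
      (f ξ * (((dphase m t e x ξ)⁻¹ ^ (j + 1) : ℝ) : ℂ)) =
      Complex.I * (Complex.exp (phase m t x ξ * Complex.I) *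
        (f ξ * (((dphase m t e x ξ)⁻¹ ^ j : ℝ) : ℂ))) := by
    intro ξ
    by_cases hξ : ξ ∈ tsupport f
    · have h1 := le_abs_dphase he (hK hξ) hx
      have h2 : 0 < 2 * Real.pi * s * |t| := by positivity
      have h3 : (dphase m t e x ξ : ℂ) ≠ 0 :=
        Complex.ofReal_ne_zero.2 (abs_pos.1 (h2.trans_le h1))
      push_cast
      rw [pow_succ]
      field_simp
    · simp [image_eq_zero_of_notMem_tsupport hξ]
  have hsum : ∀ ξ, Complex.exp (phase m t x ξ * Complex.I) *
      (fderiv ℝ f ξ e * (((dphase m t e x ξ)⁻¹ ^ (j + 1) : ℝ) : ℂ) +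
        ((j + 1) * (t * ((2 * Real.pi) ^ 2 / m * ‖e‖ ^ 2)) : ℝ) *
          (f ξ * (((dphase m t e x ξ)⁻¹ ^ (j + 2) : ℝ) : ℂ))) =
      Complex.exp (phase m t x ξ * Complex.I) *
        (fderiv ℝ f ξ e * (((dphase m t e x ξ)⁻¹ ^ (j + 1) : ℝ) : ℂ)) +
      ((j + 1) * (t * ((2 * Real.pi) ^ 2 / m * ‖e‖ ^ 2)) : ℝ) *
        (Complex.exp (phase m t x ξ * Complex.I) *
          (f ξ * (((dphase m t e x ξ)⁻¹ ^ (j + 2) : ℝ) : ℂ))) := by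
    intro ξ
    ring
  have ibp := integral_bilinear_hasLineDerivAt_right_eq_neg_left_of_integrable
    (μ := (volume : Measure (Space ν))) (v := e) (B := ContinuousLinearMap.mul ℝ ℂ)
    (f := fun ξ => Complex.exp (phase m t x ξ * Complex.I))
    (g := fun ξ => f ξ * (((dphase m t e x ξ)⁻¹ ^ (j + 1) : ℝ) : ℂ))
    (f' := fun ξ => Complex.I * dphase m t e x ξ * Complex.exp (phase m t x ξ * Complex.I))
    (g' := fun ξ => fderiv ℝ f ξ e * (((dphase m t e x ξ)⁻¹ ^ (j + 1) : ℝ) : ℂ) +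
        ((j + 1) * (t * ((2 * Real.pi) ^ 2 / m * ‖e‖ ^ 2)) : ℝ) *
          (f ξ * (((dphase m t e x ξ)⁻¹ ^ (j + 2) : ℝ) : ℂ)))
  simp only [ContinuousLinearMap.mul_apply', key, hsum] at ibp
  have h := ibp (i4.const_mul _) (i1.add (i2.const_mul _)) i3
    (fun ξ _ => hasLineDerivAt_cexp_phase t e x ξ)
    (fun ξ _ => hasLineDerivAt_mul_inv_dphase_pow hs he hf hK ht hx j ξ)
  rw [integral_add i1 (i2.const_mul _), integral_const_mul, integral_const_mul] at h
  rw [h, mul_neg, ← mul_assoc, Complex.I_mul_I]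
  ring

end

/-- Nonstationary phase: rapid decay of the oscillatory integrals in the region `|x| ≤ s|t|`. -/
theorem norm_integral_cexp_phase_le {s : ℝ} {e : Space ν} (hs : 0 < s) (he : ‖e‖ ≤ 1) (N : ℕ) :
    ∀ f : Space ν → ℂ, ContDiff ℝ ∞ f → HasCompactSupport f → tsupport f ⊆ fastSet m s e →
    ∀ j : ℕ, ∃ C : ℝ, 0 ≤ C ∧ ∀ (t : ℝ) (x : Space ν), t ≠ 0 → ‖x‖ ≤ s * |t| →
      ‖∫ ξ, Complex.exp (phase m t x ξ * Complex.I) *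
        (f ξ * (((dphase m t e x ξ)⁻¹ ^ j : ℝ) : ℂ))‖ ≤ C * |t|⁻¹ ^ (N + j) := by
  -- `f` and `j` stay universally quantified, since each step passes to a derivative of `f` and to
  -- higher powers `j`.
  induction N with
  | zero =>
    intro f hf hfc hK j
    refine ⟨(2 * Real.pi * s)⁻¹ ^ j * ∫ ξ, ‖f ξ‖, by positivity, fun t x ht hx => ?_⟩
    have hi : Integrable f := hf.continuous.integrable_of_hasCompactSupport hfc
    calc _ ≤ ∫ ξ, (2 * Real.pi * s * |t|)⁻¹ ^ j * ‖f ξ‖ := by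
          refine norm_integral_le_of_norm_le (hi.norm.const_mul _)
            (Filter.Eventually.of_forall fun ξ => ?_)
          rw [norm_mul, Complex.norm_exp_ofReal_mul_I, one_mul, norm_mul, mul_comm]
          by_cases hξ : ξ ∈ tsupport f
          · refine mul_le_mul_of_nonneg_right ?_ (norm_nonneg _)
            rw [Complex.norm_real, norm_pow, norm_inv, Real.norm_eq_abs]
            have h2 : 0 < 2 * Real.pi * s * |t| := by positivity
            exact pow_le_pow_left₀ (by positivity)
              (inv_anti₀ h2 (le_abs_dphase he (hK hξ) hx)) _
          · simp [image_eq_zero_of_notMem_tsupport hξ]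
      _ = _ := by
          rw [integral_const_mul, zero_add, mul_inv (2 * Real.pi * s), mul_pow]
          ring
  | succ N ih =>
    intro f hf hfc hK j
    have hfc' : HasCompactSupport fun ξ => fderiv ℝ f ξ e := hfc.fderiv_apply ℝ e
    have hf' : ContDiff ℝ ∞ fun ξ => fderiv ℝ f ξ e :=
      (hf.fderiv_right (m := ∞) (by simp)).clm_apply contDiff_const
    have hK' : tsupport (fun ξ => fderiv ℝ f ξ e) ⊆ fastSet m s e :=
      (tsupport_fderiv_apply_subset ℝ e).trans hK
    -- The first term gains one power of `|t|⁻¹`; the second gains two but carries a factor `t`. The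
    -- net gain is one power in both.
    obtain ⟨C₁, h1, H1⟩ := ih _ hf' hfc' hK' (j + 1)
    obtain ⟨C₂, h2, H2⟩ := ih f hf hfc hK (j + 2)
    set κ : ℝ := (2 * Real.pi) ^ 2 / m * ‖e‖ ^ 2 with hκ
    refine ⟨C₁ + (j + 1) * |κ| * C₂, by positivity, fun t x ht hx => ?_⟩
    rw [integral_cexp_phase_eq hs he hf hfc hK ht hx j, norm_mul, Complex.norm_I, one_mul]
    refine (norm_add_le _ _).trans ?_
    rw [norm_mul, Complex.norm_real, norm_mul, norm_mul, Real.norm_eq_abs t, ← hκ,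
      Real.norm_eq_abs κ, Real.norm_of_nonneg (by positivity : (0 : ℝ) ≤ j + 1)]
    have ht' : |t| ≠ 0 := abs_ne_zero.2 ht
    calc _ ≤ C₁ * |t|⁻¹ ^ (N + (j + 1)) +
          (j + 1) * (|t| * |κ|) * (C₂ * |t|⁻¹ ^ (N + (j + 2))) := by
          gcongr
          · exact H1 t x ht hx
          · exact H2 t x ht hx
      _ = _ := by
          rw [show N + (j + 1) = N + 1 + j by ring, show N + (j + 2) = N + 1 + j + 1 by ring,
            pow_succ _ (N + 1 + j)]
          field_simp

/-- A wave function with a smooth compactly supported Fourier transform evolves into an explicit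
oscillatory integral. -/
theorem coeFn_freeEvol (hm : 0 < m) {Φ : Hilb ν} {f : Space ν → ℂ}
    (hΦ : (𝓕 Φ : Hilb ν) =ᵐ[volume] f) (hf : ContDiff ℝ ∞ f) (hfc : HasCompactSupport f) (t : ℝ) :
    freeEvol m t Φ =ᵐ[volume] fun x => ∫ ξ, Complex.exp (phase m t x ξ * Complex.I) * f ξ := by
  set g : Space ν → ℂ := fun ξ =>
    Complex.exp (-(Complex.I * t * kineticEnergy m ((2 * Real.pi) • ξ))) * f ξ with hg
  have hk : ContDiff ℝ ∞ fun ξ : Space ν => kineticEnergy m ((2 * Real.pi) • ξ) :=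
    ((contDiff_const_smul _).norm_sq ℝ).div_const _
  have hgd : ContDiff ℝ ∞ g :=
    ((contDiff_const.mul (Complex.ofRealCLM.contDiff.comp hk)).neg.cexp).mul hf
  have hgc : HasCompactSupport g := hfc.mul_left
  set G : SchwartzMap (Space ν) ℂ := hgc.toSchwartzMap hgd with hG
  have hGg : ⇑G = g := rfl
  have h1 : (𝓕 (freeEvol m t Φ) : Hilb ν) = G.toLp 2 volume := by
    apply Lp.ext
    refine (fourier_funcH0 (inDomain_freeEvol hm t Φ)).trans ((symbolMul_congr hΦ).trans ?_)
    exact (G.coeFn_toLp 2 volume).symm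
  have h2 : freeEvol m t Φ = (𝓕⁻ G).toLp 2 volume := by
    rw [← SchwartzMap.toLp_fourierInv_eq, ← h1, FourierTransform.fourierInv_fourier_eq]
  rw [h2]
  refine ((𝓕⁻ G).coeFn_toLp 2 volume).trans (Filter.EventuallyEq.of_eq ?_)
  ext x
  rw [SchwartzMap.fourierInv_coe, Real.fourierInv_eq', hGg]
  refine integral_congr_ae (Filter.Eventually.of_forall fun ξ => ?_)
  simp only [hg, smul_eq_mul]
  rw [← mul_assoc, ← Complex.exp_add, phase]
  congr 2
  push_cast
  ring

/-! ### Potentials applied to wide cutoff functions -/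

theorem fourier_comp_inv_smul (g : Space ν → ℂ) {ρ : ℝ} (hρ : 0 < ρ) (ξ : Space ν) :
    𝓕 (fun x => g (ρ⁻¹ • x)) ξ = ((ρ ^ ν : ℝ) : ℂ) * 𝓕 g (ρ • ξ) := by
  rw [Real.fourier_eq', Real.fourier_eq']
  have h := Measure.integral_comp_inv_smul (volume : Measure (Space ν))
    (fun y => Complex.exp (((-2 * Real.pi * ⟪y, ρ • ξ⟫_ℝ : ℝ) : ℂ) * Complex.I) • g y) ρ
  rw [finrank_euclideanSpace_fin, abs_of_pos (pow_pos hρ ν), Complex.real_smul] at h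
  rw [← h]
  refine integral_congr_ae (Filter.Eventually.of_forall fun x => ?_)
  simp only [real_inner_smul_left, real_inner_smul_right, mul_inv_cancel_left₀ hρ.ne']

/-- The squared weight decays with exponent `2(ν + 1) > ν`, hence is integrable. -/
theorem memLp_two_one_add_norm_inv_pow :
    MemLp (fun ξ : Space ν => (1 + ‖ξ‖)⁻¹ ^ (ν + 1)) 2 volume := by
  have hc : Continuous fun ξ : Space ν => (1 + ‖ξ‖)⁻¹ ^ (ν + 1) :=
    ((continuous_const.add continuous_norm).inv₀
      fun ξ => (by positivity : (0 : ℝ) < 1 + ‖ξ‖).ne').pow _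
  rw [memLp_two_iff_integrable_sq hc.aestronglyMeasurable]
  have h := integrable_one_add_norm (E := Space ν) (μ := volume) (r := ((2 * (ν + 1) : ℕ) : ℝ))
    (by rw [finrank_euclideanSpace_fin]; push_cast; linarith [(Nat.cast_nonneg ν : (0 : ℝ) ≤ ν)])
  refine h.congr (Filter.Eventually.of_forall fun ξ => ?_)
  simp only
  rw [Real.rpow_neg (by positivity), Real.rpow_natCast, ← pow_mul, inv_pow, mul_comm]

/-- Dilation by `ρ ≥ 1` multiplies the transform by `ρ ^ ν` and stretches its argument, so `‖G‖` and
`‖H₀ G‖` are both `O(ρ ^ ν)`. The power is not optimal, but any polynomial growth suffices. The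
constant depends on `U` only through `a` and `b`, so it serves all rotated potentials. -/
theorem exists_mulNorm_scaled_le (hm : 0 < m) (a b : ℝ≥0) (g : SchwartzMap (Space ν) ℂ) :
    ∃ C : ℝ≥0, ∀ (U : Space ν → ℝ), KatoWith m a b U → ∀ (ρ : ℝ), 1 ≤ ρ →
      ∀ G : SchwartzMap (Space ν) ℂ, (∀ x, G x = g (ρ⁻¹ • x)) →
        mulNorm U (G.toLp 2 volume) ≤ ENNReal.ofReal (C * ρ ^ ν) := by
  set q : Space ν → ℝ := fun ξ => (1 + ‖ξ‖)⁻¹ ^ (ν + 1) with hq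
  have hqL : MemLp q 2 volume := memLp_two_one_add_norm_inv_pow
  -- Of the `ν + 3` powers of decay, two absorb the kinetic energy and the other `ν + 1` form the
  -- square integrable weight `q`.
  obtain ⟨M, hM⟩ : ∃ M : ℝ≥0, ∀ ξ, ‖(𝓕 g) ξ‖ ≤ M * ((1 + ‖ξ‖)⁻¹ ^ 2 * q ξ) := by
    have h := fun ξ => SchwartzMap.one_add_le_sup_seminorm_apply (𝕜 := ℂ) (m := (ν + 3, 0))
      (k := ν + 3) (n := 0) le_rfl le_rfl (𝓕 g) ξ
    refine ⟨⟨_, le_trans (by positivity) (h 0)⟩, fun ξ => ?_⟩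
    have h' := h ξ
    rw [norm_iteratedFDeriv_zero] at h'
    have hp : 0 < (1 + ‖ξ‖) ^ (ν + 3) := by positivity
    rw [hq, ← pow_add, show 2 + (ν + 1) = ν + 3 by ring, inv_pow, ← div_eq_mul_inv, le_div_iff₀ hp,
      mul_comm]
    exact h'
  set B : ℝ≥0 := ⟨(2 * Real.pi) ^ 2 / (2 * m), by positivity⟩ with hB
  have hBr : (B : ℝ) = (2 * Real.pi) ^ 2 / (2 * m) := rfl
  set Q : ℝ≥0 := (eLpNorm q 2 volume).toNNReal with hQ
  have hQe : eLpNorm q 2 volume = Q := (ENNReal.coe_toNNReal hqL.2.ne).symm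
  refine ⟨(a * B + b) * M * Q, fun U hU ρ hρ G hG => ?_⟩
  have hρ0 : 0 < ρ := one_pos.trans_le hρ
  have hGeq : ⇑G = fun x => g (ρ⁻¹ • x) := funext hG
  have hFG : ∀ ξ, ‖(𝓕 G) ξ‖ ≤ ρ ^ ν * M * ((1 + ‖ξ‖)⁻¹ ^ 2 * q ξ) := by
    intro ξ
    rw [SchwartzMap.fourier_coe, hGeq, fourier_comp_inv_smul _ hρ0, norm_mul, Complex.norm_real,
      Real.norm_of_nonneg (by positivity), ← SchwartzMap.fourier_coe, mul_assoc]
    refine mul_le_mul_of_nonneg_left ((hM _).trans ?_) (by positivity)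
    have h1 : (1 + ‖ρ • ξ‖)⁻¹ ≤ (1 + ‖ξ‖)⁻¹ := by
      refine inv_anti₀ (by positivity) ?_
      rw [norm_smul, Real.norm_of_nonneg hρ0.le]
      nlinarith [norm_nonneg ξ]
    simp only [hq]
    gcongr
  have hae : (𝓕 (G.toLp 2 volume : Hilb ν) : Hilb ν) =ᵐ[volume]
      ⇑(𝓕 G : SchwartzMap (Space ν) ℂ) := by
    rw [SchwartzMap.toLp_fourier_eq]
    exact (𝓕 G).coeFn_toLp 2 volume
  have hle1 : ∀ ξ : Space ν, (1 + ‖ξ‖)⁻¹ ^ 2 ≤ 1 := fun ξ =>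
    pow_le_one₀ (by positivity) (inv_le_one_of_one_le₀ (by linarith [norm_nonneg ξ]))
  have hq0 : ∀ ξ, 0 ≤ q ξ := fun ξ => by positivity
  set R : ℝ≥0 := ⟨ρ ^ ν, by positivity⟩ with hR
  have hRr : (R : ℝ) = ρ ^ ν := rfl
  have e1 : ‖(G.toLp 2 volume : Hilb ν)‖ₑ ≤ (R * M * Q : ℝ≥0) := by
    rw [← enorm_fourier, Lp.enorm_def, eLpNorm_congr_ae hae, ENNReal.coe_mul, ← hQe]
    refine eLpNorm_le_nnreal_smul_eLpNorm_of_ae_le_mul (Filter.Eventually.of_forall fun ξ => ?_) 2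
    rw [← NNReal.coe_le_coe, coe_nnnorm, NNReal.coe_mul, NNReal.coe_mul, coe_nnnorm,
      Real.norm_of_nonneg (hq0 ξ), hRr]
    exact (hFG ξ).trans (mul_le_mul_of_nonneg_left
      (mul_le_of_le_one_left (hq0 ξ) (hle1 ξ)) (by positivity))
  have hsym : ∀ᵐ ξ, ‖symbolMul m (fun l => (l : ℂ)) (G.toLp 2 volume : Hilb ν) ξ‖ ≤
      B * R * M * ‖q ξ‖ := by
    filter_upwards [symbolMul_congr (m := m) (a := fun l => (l : ℂ)) hae] with ξ hξ
    rw [hξ, norm_mul, Complex.norm_real, Real.norm_of_nonneg (kineticEnergy_nonneg hm _),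
      Real.norm_of_nonneg (hq0 ξ)]
    have h1 : kineticEnergy m ((2 * Real.pi) • ξ) ≤ B * (1 + ‖ξ‖) ^ 2 := by
      rw [kineticEnergy, norm_smul, Real.norm_of_nonneg Real.two_pi_pos.le, hBr, mul_pow,
        div_mul_eq_mul_div]
      gcongr
      linarith
    calc _ ≤ B * (1 + ‖ξ‖) ^ 2 * (ρ ^ ν * M * ((1 + ‖ξ‖)⁻¹ ^ 2 * q ξ)) :=
          mul_le_mul h1 (hFG ξ) (norm_nonneg _) (by positivity)
      _ = _ := by
          rw [hRr]
          field_simp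
  have hdom : InDomain m (fun l => (l : ℂ)) (G.toLp 2 volume : Hilb ν) := by
    refine MemLp.of_le_mul hqL ?_ hsym
    exact (Complex.measurable_ofReal.comp
      (by unfold kineticEnergy; fun_prop)).aestronglyMeasurable.mul (Lp.aestronglyMeasurable _)
  have e2 : ‖freeHam m (G.toLp 2 volume : Hilb ν)‖ₑ ≤ (B * R * M * Q : ℝ≥0) := by
    rw [freeHam, enorm_funcH0 hdom, ENNReal.coe_mul, ← hQe]
    refine eLpNorm_le_nnreal_smul_eLpNorm_of_ae_le_mul ?_ 2
    filter_upwards [hsym] with ξ hξ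
    rw [← NNReal.coe_le_coe]
    exact_mod_cast hξ
  refine (hU _ hdom).trans ((add_le_add (mul_le_mul_right e2 _) (mul_le_mul_right e1 _)).trans ?_)
  rw [← hRr, ← NNReal.coe_mul, ENNReal.ofReal_coe_nnreal]
  norm_cast
  refine le_of_eq ?_
  ring

/-- The dilated smooth cutoff functions. -/
theorem exists_scaled (g : SchwartzMap (Space ν) ℂ) {ρ : ℝ} (hρ : 0 < ρ) :
    ∃ G : SchwartzMap (Space ν) ℂ, ∀ x, G x = g (ρ⁻¹ • x) :=
  ⟨SchwartzMap.compCLMOfContinuousLinearEquiv ℂ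
    (ContinuousLinearEquiv.smulLeft (Units.mk0 ρ⁻¹ (inv_ne_zero hρ.ne'))) g, fun _ => rfl⟩

theorem exists_schwartz_cutoff :
    ∃ g : SchwartzMap (Space ν) ℂ, ∀ x, ‖x‖ ≤ 1 → g x = 1 := by
  let χ : ContDiffBump (0 : Space ν) := ⟨1, 2, one_pos, one_lt_two⟩
  have h1 : ContDiff ℝ ∞ fun x => (χ x : ℂ) := Complex.ofRealCLM.contDiff.comp χ.contDiff
  have h2 : HasCompactSupport fun x => (χ x : ℂ) :=
    χ.hasCompactSupport.comp_left Complex.ofReal_zero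
  refine ⟨h2.toSchwartzMap h1, fun x hx => ?_⟩
  change (χ x : ℂ) = 1
  rw [χ.one_of_mem_closedBall (by simpa using hx), Complex.ofReal_one]

/-- A Kato-bounded potential applied to the part of a freely evolving state that lags behind. -/
theorem exists_mulNorm_sub_cutSpace_le (hm : 0 < m) {s : ℝ} {e : Space ν} (hs : 0 < s)
    (he : ‖e‖ ≤ 1) {Φ : Hilb ν} {f : Space ν → ℂ} (hΦ : (𝓕 Φ : Hilb ν) =ᵐ[volume] f)
    (hf : ContDiff ℝ ∞ f) (hfc : HasCompactSupport f) (hK : tsupport f ⊆ fastSet m s e)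
    (a b : ℝ≥0) (N : ℕ) :
    ∃ C : ℝ, 0 ≤ C ∧ ∀ U : Space ν → ℝ, KatoWith m a b U → ∀ t : ℝ, 1 ≤ |t| →
      mulNorm U (freeEvol m t Φ - cutSpace (s * |t|) (freeEvol m t Φ)) ≤
        ENNReal.ofReal (C * |t|⁻¹ ^ N) := by
  -- The extra `ν` powers pay for the growth of the dilated cutoff.
  obtain ⟨C₁, hC₁, H₁⟩ := norm_integral_cexp_phase_le (m := m) hs he (N + ν) f hf hfc hK 0
  obtain ⟨g, hg⟩ := exists_schwartz_cutoff (ν := ν)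
  obtain ⟨C₂, H₂⟩ := exists_mulNorm_scaled_le hm a b g
  refine ⟨C₁ * (C₂ * (1 + s) ^ ν), by positivity, fun U hU t ht => ?_⟩
  have ht0 : t ≠ 0 := abs_pos.1 (one_pos.trans_le ht)
  -- The scale is `1 + s|t|` because the bound on dilated cutoffs needs a scale of at least `1`,
  -- while `s|t|` may be smaller.
  have hρ : 1 ≤ 1 + s * |t| := by linarith [mul_nonneg hs.le (abs_nonneg t)]
  obtain ⟨G, hG⟩ := exists_scaled g (one_pos.trans_le hρ)
  have h2 := H₂ U hU _ hρ G hG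
  set c : ℝ≥0 := ⟨C₁ * |t|⁻¹ ^ (N + ν), by positivity⟩ with hc
  have hcr : (c : ℝ) = C₁ * |t|⁻¹ ^ (N + ν) := rfl
  -- Pointwise domination by `c * |G|` avoids applying the Kato bound to the sharply truncated
  -- state, whose membership in the domain of `H₀` is not available.
  have h1 : mulNorm U (freeEvol m t Φ - cutSpace (s * |t|) (freeEvol m t Φ)) ≤
      c * mulNorm U (G.toLp 2 volume) := by
    refine eLpNorm_le_nnreal_smul_eLpNorm_of_ae_le_mul ?_ 2
    filter_upwards [coeFn_sub_cutSpace (s * |t|) (freeEvol m t Φ), coeFn_freeEvol hm hΦ hf hfc t,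
      G.coeFn_toLp 2 volume] with x h3 h4 h5
    rw [h3, h5, nnnorm_mul, nnnorm_mul, mul_left_comm]
    refine mul_le_mul_right ?_ _
    rw [← NNReal.coe_le_coe, NNReal.coe_mul, coe_nnnorm, coe_nnnorm, hcr]
    by_cases hx : ‖x‖ ≤ s * |t|
    · have h6 : G x = 1 := by
        rw [hG]
        refine hg _ ?_
        rw [norm_smul, norm_inv, Real.norm_of_nonneg (by linarith), inv_mul_le_one₀ (by linarith)]
        linarith
      rw [indicator_of_mem (by exact hx), h4, h6, norm_one, mul_one]
      simpa using H₁ t x ht0 hx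
    · rw [indicator_of_notMem (by exact hx), norm_zero]
      positivity
  refine h1.trans ((mul_le_mul_right h2 _).trans ?_)
  rw [← ENNReal.ofReal_coe_nnreal, ← ENNReal.ofReal_mul (NNReal.coe_nonneg c), hcr]
  refine ENNReal.ofReal_le_ofReal ?_
  have h7 : 1 + s * |t| ≤ (1 + s) * |t| := by linarith
  have h8 : |t| ≠ 0 := abs_ne_zero.2 ht0
  calc _ ≤ C₁ * |t|⁻¹ ^ (N + ν) * (C₂ * ((1 + s) * |t|) ^ ν) := by gcongr
    _ = _ := by
      rw [pow_add, mul_pow, inv_pow _ ν]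
      field_simp

/-! ### Integrable decay of a rotated potential along a free trajectory -/

theorem integrable_comp_mul_abs {h : ℝ → ℝ} (hh : IntegrableOn h (Ici 0) volume) {s : ℝ}
    (hs : 0 < s) : Integrable (fun t => h (s * |t|)) volume := by
  have h1 : IntegrableOn (fun t => h (s * |t|)) (Ioi 0) volume := by
    have h2 : IntegrableOn (fun t => h (s * t)) (Ioi 0) volume := by
      rw [integrableOn_Ioi_comp_mul_left_iff _ _ hs, mul_zero]
      exact hh.mono_set Ioi_subset_Ici_self
    refine h2.congr_fun (fun t ht => ?_) measurableSet_Ioi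
    simp only [abs_of_pos (mem_Ioi.1 ht)]
  have h2 : IntegrableOn (fun t => h (s * |t|)) (Iic 0) volume := by
    rw [integrableOn_Iic_iff_integrableOn_Iio]
    have h3 := (Measure.measurePreserving_neg (volume : Measure ℝ)).integrableOn_comp_preimage
      (Homeomorph.neg ℝ).measurableEmbedding (f := fun t => h (s * |t|)) (s := Ioi 0)
    have h4 := h3.2 h1
    have h5 : (Neg.neg : ℝ → ℝ) ⁻¹' Ioi 0 = Iio 0 := by
      ext t
      simp
    rw [h5] at h4
    refine h4.congr_fun (fun t _ => ?_) measurableSet_Iio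
    simp [Function.comp]
  have := h2.union h1
  rwa [Iic_union_Ioi, integrableOn_univ] at this

/-- The common core of all cases: `A` is the identity, the resolvent or `g(H₀)`. The bound `h` does
not depend on `L`, so `L` may afterwards be the rotation at time `t`. -/
theorem exists_integrable_bound {A : Hilb ν →ₗ[ℂ] Hilb ν}
    (hm : 0 < m)
    (hA : ∀ (L : Space ν ≃ₗᵢ[ℝ] Space ν) (Ψ : Hilb ν), A (compL L Ψ) = compL L (A Ψ))
    {a b : ℝ≥0} {U : Space ν → ℝ} (hU : AEMeasurable U volume) (hKU : KatoWith m a b U)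
    {Φ Φ' : Hilb ν} (hΦ : ∀ t, A (freeEvol m t Φ') = freeEvol m t Φ) {s : ℝ} (hs : 0 < s) {κ : ℕ}
    (hrem : ∃ C : ℝ, 0 ≤ C ∧ ∀ U' : Space ν → ℝ, KatoWith m a b U' → ∀ t : ℝ, 1 ≤ |t| →
      mulNorm U' (A (freeEvol m t Φ' - cutSpace (s * |t|) (freeEvol m t Φ'))) ≤
        ENNReal.ofReal (C * |t|⁻¹ ^ (κ + 2)))
    (hbd : ∃ C : ℝ, 0 ≤ C ∧ ∀ U' : Space ν → ℝ, KatoWith m a b U' → ∀ t : ℝ,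
      mulNorm U' (freeEvol m t Φ) ≤ ENNReal.ofReal C)
    (hM : HasIntegrableBound fun ρ =>
      ENNReal.ofReal (ρ ^ κ) * mulOpNorm U (fun Ψ => A (cutSpace ρ Ψ))) :
    ∃ h : ℝ → ℝ, (∀ t, 0 < h t) ∧ Integrable h volume ∧ (∀ t, h |t| = h t) ∧
      ∀ (L : Space ν ≃ₗᵢ[ℝ] Space ν) (t : ℝ),
        ENNReal.ofReal ((1 + |t|) ^ κ) * mulNorm (fun x => U (L.symm x)) (freeEvol m t Φ) ≤
          ENNReal.ofReal (h t) := by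
  obtain ⟨C, hC, HC⟩ := hrem
  obtain ⟨D, hD, HD⟩ := hbd
  obtain ⟨w, hw, Hw⟩ := hM
  -- In `c₁`, `2 ^ κ` comes from `1 + |t| ≤ 2|t|` and `s⁻¹ ^ κ` turns `|t| ^ κ` into `(s|t|) ^ κ`.
  -- In `c₂`, the additional factor `2` covers `1 + t² ≤ 2` for small times and `1 + t² ≤ 2t²` for
  -- large ones; the summand `1` makes `h` strictly positive.
  set c₁ : ℝ := 2 ^ κ * s⁻¹ ^ κ * ‖Φ'‖ with hc₁
  have hc₁0 : 0 ≤ c₁ := by positivity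
  set c₂ : ℝ := 2 ^ (κ + 1) * (D + C) + 1 with hc₂
  have hpos : ∀ t : ℝ, 0 < c₂ * (1 + t ^ 2)⁻¹ := fun t => by positivity
  refine ⟨fun t => c₁ * |w (s * |t|)| + c₂ * (1 + t ^ 2)⁻¹, fun t => ?_, ?_, fun t => ?_,
    fun L t => ?_⟩
  · exact add_pos_of_nonneg_of_pos (by positivity) (hpos t)
  · exact ((integrable_comp_mul_abs hw hs).abs.const_mul _).add
      (integrable_inv_one_add_sq.const_mul _)
  · simp only [abs_abs, sq_abs]
  · have hUL : AEMeasurable (fun x => U (L.symm x)) volume :=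
      hU.comp_quasiMeasurePreserving L.symm.measurePreserving.quasiMeasurePreserving
    have hKL := hKU.comp_symm hU L
    have hw0 : 0 ≤ c₁ * |w (s * |t|)| := by positivity
    rcases lt_or_ge |t| 1 with ht | ht
    · calc _ ≤ ENNReal.ofReal (2 ^ κ) * ENNReal.ofReal D := by
            gcongr
            · linarith
            · exact HD _ hKL t
        _ = ENNReal.ofReal (2 ^ κ * D) := (ENNReal.ofReal_mul (by positivity)).symm
        _ ≤ _ := by
            refine ENNReal.ofReal_le_ofReal (le_trans ?_ (le_add_of_nonneg_left hw0))
            have h1 : t ^ 2 ≤ 1 := by rw [← sq_abs]; nlinarith [abs_nonneg t]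
            rw [← div_eq_mul_inv, le_div_iff₀ (by positivity), hc₂, pow_succ (2 : ℝ) κ]
            have h2 : 0 ≤ (2 : ℝ) ^ κ * D := by positivity
            have h3 : 0 ≤ (2 : ℝ) ^ κ * C := by positivity
            nlinarith
    · have ht0 : 0 < |t| := one_pos.trans_le ht
      have hρ : 0 < s * |t| := mul_pos hs ht0
      set u := freeEvol m t Φ' with hu
      -- Leading part plus lagging part of `u`: the decay hypothesis bounds the first, `hrem` the
      -- second.
      have hsplit : freeEvol m t Φ =
          A (cutSpace (s * |t|) u) + A (u - cutSpace (s * |t|) u) := by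
        rw [← map_add, add_sub_cancel, hΦ]
      have h1 : mulNorm (fun x => U (L.symm x)) (A (cutSpace (s * |t|) u)) ≤
          mulOpNorm U (fun Ψ => A (cutSpace (s * |t|) Ψ)) * ENNReal.ofReal ‖Φ'‖ := by
        refine (mulNorm_le_mulOpNorm_mul _ (A ∘ₗ cutSpaceₗ (s * |t|)) u).trans ?_
        refine mul_le_mul' ?_ ?_
        · exact mulOpNorm_comp_symm_le hU L fun Ψ => by
            change A (cutSpace _ (compL L Ψ)) = compL L (A (cutSpace _ Ψ))
            rw [cutSpace_compL, hA]
        · rw [ofReal_norm]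
          exact enorm_freeEvol_le hm t Φ'
      have h2 := HC _ hKL t ht
      have h3 := Hw _ hρ
      have e1 : (1 + |t|) ^ κ ≤ 2 ^ κ * |t| ^ κ := by
        rw [← mul_pow]
        gcongr
        linarith
      have e2 : (2 : ℝ) ^ κ * |t| ^ κ * ‖Φ'‖ = c₁ * (s * |t|) ^ κ := by
        rw [hc₁, mul_pow, inv_pow]
        field_simp
      calc _ ≤ ENNReal.ofReal (2 ^ κ * |t| ^ κ) *
            (mulOpNorm U (fun Ψ => A (cutSpace (s * |t|) Ψ)) * ENNReal.ofReal ‖Φ'‖ +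
              ENNReal.ofReal (C * |t|⁻¹ ^ (κ + 2))) := by
            rw [hsplit]
            exact mul_le_mul' (ENNReal.ofReal_le_ofReal e1)
              ((mulNorm_add_le hUL _ _).trans (add_le_add h1 h2))
        _ = ENNReal.ofReal c₁ * (ENNReal.ofReal ((s * |t|) ^ κ) *
              mulOpNorm U (fun Ψ => A (cutSpace (s * |t|) Ψ))) +
            ENNReal.ofReal (2 ^ κ * |t| ^ κ * (C * |t|⁻¹ ^ (κ + 2))) := by
            rw [mul_add, ← ENNReal.ofReal_mul (by positivity), ← mul_assoc (ENNReal.ofReal c₁),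
              ← ENNReal.ofReal_mul hc₁0, ← e2, ENNReal.ofReal_mul (q := ‖Φ'‖) (by positivity)]
            ring
        _ ≤ ENNReal.ofReal c₁ * ENNReal.ofReal |w (s * |t|)| +
            ENNReal.ofReal (c₂ * (1 + t ^ 2)⁻¹) := by
            refine add_le_add (mul_le_mul_right (h3.trans
              (ENNReal.ofReal_le_ofReal (le_abs_self _))) _) (ENNReal.ofReal_le_ofReal ?_)
            have h4 : (2 : ℝ) ^ κ * |t| ^ κ * (C * |t|⁻¹ ^ (κ + 2)) = 2 ^ κ * C / t ^ 2 := by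
              rw [← sq_abs t, pow_add, inv_pow, inv_pow]
              field_simp
            have h5 : 1 ≤ t ^ 2 := by rw [← sq_abs]; nlinarith
            have h6 : 0 ≤ (2 : ℝ) ^ κ * D := by positivity
            have h7 : 0 ≤ (2 : ℝ) ^ κ * C := by positivity
            rw [h4, ← div_eq_mul_inv, div_le_div_iff₀ (by positivity) (by positivity), hc₂,
              pow_succ (2 : ℝ) κ]
            nlinarith
        _ = _ := by
            rw [← ENNReal.ofReal_mul hc₁0, ← ENNReal.ofReal_add hw0 (hpos t).le]

/-! ### States with separated momenta -/

/-- The Fourier transform of `Φ` is smooth, with compact support in the momenta of velocity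
component at least `2s` along `e`. -/
structure FastState (m s : ℝ) (e : Space ν) (Φ : Hilb ν) (f : Space ν → ℂ) : Prop where
  speed_pos : 0 < s
  direction_le : ‖e‖ ≤ 1
  fourier_eq : (𝓕 Φ : Hilb ν) =ᵐ[volume] f
  contDiff : ContDiff ℝ ∞ f
  hasCompactSupport : HasCompactSupport f
  tsupport_subset : tsupport f ⊆ fastSet m s e

theorem exists_fastState (hm : 0 < m) {Φ : Hilb ν} (hΦ : Φ ∈ goodStates ν m) :
    ∃ s e f, FastState m s e Φ f := by
  obtain ⟨-, φ, hφ, hφs, hφc, v, hv, hsupp⟩ := hΦ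
  have hv' : 0 < ‖v‖ := norm_pos_iff.2 hv
  have h2π := Real.two_pi_pos
  set c : ℝ := (2 * Real.pi) ^ (-(ν : ℝ) / 2) with hc
  have hc0 : (c : ℂ) ≠ 0 := Complex.ofReal_ne_zero.2 (Real.rpow_pos_of_pos h2π _).ne'
  set D : Space ν ≃ₜ Space ν := Homeomorph.smulOfNeZero (2 * Real.pi) h2π.ne' with hD
  have hDx : ∀ ξ, D ξ = (2 * Real.pi) • ξ := fun _ => rfl
  have hcomp : HasCompactSupport fun ξ => φ ((2 * Real.pi) • ξ) :=
    hφc.comp_homeomorph D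
  -- The last witness undoes the normalization of `momentumWF`. Within the ball the velocity
  -- component along `v` is at least `|v| - |v|/3 = 2s`.
  refine ⟨‖v‖ / 3, ‖v‖⁻¹ • v, fun ξ => (c : ℂ)⁻¹ * φ ((2 * Real.pi) • ξ), by positivity, ?_, ?_,
    ?_, hcomp.mul_left, ?_⟩
  · rw [norm_smul, norm_inv, norm_norm, inv_mul_cancel₀ hv'.ne']
  · have hq : Measure.QuasiMeasurePreserving (fun ξ : Space ν => (2 * Real.pi) • ξ) volume volume :=
      Measure.quasiMeasurePreserving_smul volume h2π.ne'
    filter_upwards [hq.ae_eq_comp hφ] with ξ hξ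
    simp only [Function.comp, momentumWF, smul_smul, inv_mul_cancel₀ h2π.ne', one_smul] at hξ
    rw [← hξ, inv_mul_cancel_left₀ hc0]
  · exact contDiff_const.mul (hφs.comp (contDiff_const_smul _))
  · intro ξ hξ
    have h1 : ξ ∈ tsupport (φ ∘ D) := tsupport_mul_subset_right hξ
    rw [tsupport_comp_eq_preimage] at h1
    have h2 := hsupp h1
    rw [hDx, mem_ball_iff_norm] at h2
    have h3 : ⟪m • v - (2 * Real.pi) • ξ, ‖v‖⁻¹ • v⟫_ℝ ≤ m * ‖v‖ / 3 := by
      refine (real_inner_le_norm _ _).trans ?_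
      rw [norm_smul ‖v‖⁻¹, norm_inv, norm_norm, inv_mul_cancel₀ hv'.ne', mul_one, norm_sub_rev]
      exact h2.le
    rw [inner_sub_left, real_inner_smul_left, real_inner_smul_right, real_inner_self_eq_norm_sq,
      real_inner_smul_left] at h3
    have h4 : m * (‖v‖⁻¹ * ‖v‖ ^ 2) = m * ‖v‖ := by
      field_simp
    rw [h4] at h3
    change 2 * (‖v‖ / 3) ≤ 2 * Real.pi / m * ⟪ξ, ‖v‖⁻¹ • v⟫_ℝ
    rw [div_mul_eq_mul_div, le_div_iff₀ hm]
    linarith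

section

variable {s : ℝ} {e : Space ν} {Φ : Hilb ν} {f : Space ν → ℂ}

/-- The state with Fourier transform multiplied by a smooth function of the energy. -/
theorem FastState.exists_mul (h : FastState m s e Φ f) {q : Space ν → ℂ} (hq : ContDiff ℝ ∞ q) :
    ∃ Φ' : Hilb ν, FastState m s e Φ' (fun ξ => q ξ * f ξ) := by
  have h1 : ContDiff ℝ ∞ fun ξ => q ξ * f ξ := hq.mul h.contDiff
  have h2 : HasCompactSupport fun ξ => q ξ * f ξ := h.hasCompactSupport.mul_left
  refine ⟨𝓕⁻ ((h2.toSchwartzMap h1).toLp 2 volume : Hilb ν), h.speed_pos, h.direction_le, ?_, h1,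
    h2, tsupport_mul_subset_right.trans h.tsupport_subset⟩
  rw [FourierTransform.fourier_fourierInv_eq]
  exact (h2.toSchwartzMap h1).coeFn_toLp 2 volume

theorem norm_resolvent_symbol_le {l : ℝ} (hl : 0 ≤ l) : ‖((l : ℂ) + 1)⁻¹‖ ≤ ((1 : ℝ≥0) : ℝ) := by
  rw [norm_inv, ← Complex.ofReal_one, ← Complex.ofReal_add, Complex.norm_real,
    Real.norm_of_nonneg (by linarith), NNReal.coe_one]
  exact inv_le_one_of_one_le₀ (by linarith)

theorem norm_mul_resolvent_symbol_le {l : ℝ} (hl : 0 ≤ l) :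
    ‖(l : ℂ) * ((l : ℂ) + 1)⁻¹‖ ≤ ((1 : ℝ≥0) : ℝ) := by
  rw [norm_mul, norm_inv, ← Complex.ofReal_one, ← Complex.ofReal_add, Complex.norm_real,
    Complex.norm_real, Real.norm_of_nonneg hl, Real.norm_of_nonneg (by linarith), NNReal.coe_one,
    ← div_eq_mul_inv, div_le_one (by linarith)]
  linarith

theorem measurable_resolvent_symbol : Measurable fun l : ℝ => ((l : ℂ) + 1)⁻¹ := by
  fun_prop

/-- `Φ'` is `(H₀ + 1)Φ`: multiplying the transform by the smooth symbol keeps it smooth and does not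
enlarge its support. -/
theorem FastState.exists_resolvent (hm : 0 < m) (h : FastState m s e Φ f) :
    ∃ Φ' f', FastState m s e Φ' f' ∧
      ∀ t, funcH0 m (fun l => ((l : ℂ) + 1)⁻¹) (freeEvol m t Φ') = freeEvol m t Φ := by
  have hk : ContDiff ℝ ∞ fun ξ : Space ν => kineticEnergy m ((2 * Real.pi) • ξ) :=
    ((contDiff_const_smul _).norm_sq ℝ).div_const _
  have hq : ContDiff ℝ ∞ fun ξ : Space ν => (kineticEnergy m ((2 * Real.pi) • ξ) : ℂ) + 1 :=
    (Complex.ofRealCLM.contDiff.comp hk).add contDiff_const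
  obtain ⟨Φ', hΦ'⟩ := h.exists_mul hq
  refine ⟨Φ', _, hΦ', funcH0_freeEvol hm (fun Ψ => inDomain_of_bounded hm
    measurable_resolvent_symbol (fun _ => norm_resolvent_symbol_le) Ψ) ?_⟩
  filter_upwards [h.fourier_eq, symbolMul_congr (m := m) (a := fun l => ((l : ℂ) + 1)⁻¹)
    hΦ'.fourier_eq] with ξ h1 h2
  have h3 : (kineticEnergy m ((2 * Real.pi) • ξ) : ℂ) + 1 ≠ 0 := by
    rw [← Complex.ofReal_one, ← Complex.ofReal_add, Complex.ofReal_ne_zero]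
    have := kineticEnergy_nonneg hm ((2 * Real.pi) • ξ)
    positivity
  rw [h1, h2, inv_mul_cancel_left₀ h3]

/-- The energy is bounded on the compact support, so a bump equal to `1` on that range satisfies
`g(H₀)Φ = Φ`. -/
theorem FastState.exists_energy_cutoff (h : FastState m s e Φ f) :
    ∃ g : ℝ → ℝ, ContDiff ℝ ∞ g ∧ HasCompactSupport g ∧ (∀ l, |g l| ≤ 1) ∧
      (∃ E : ℝ≥0, ∀ l, |l * g l| ≤ E) ∧
      (𝓕 Φ : Hilb ν) =ᵐ[volume] symbolMul m (fun l => (g l : ℂ)) Φ := by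
  have hk : Continuous fun ξ : Space ν => kineticEnergy m ((2 * Real.pi) • ξ) := by
    unfold kineticEnergy
    fun_prop
  obtain ⟨E, hE⟩ := h.hasCompactSupport.isCompact.exists_bound_of_continuousOn hk.continuousOn
  let χ : ContDiffBump (0 : ℝ) := ⟨|E| + 1, |E| + 2, by positivity, by linarith⟩
  have hχ1 : ∀ l, |χ l| ≤ 1 := fun l => by
    rw [abs_of_nonneg χ.nonneg]
    exact χ.le_one
  refine ⟨χ, χ.contDiff, χ.hasCompactSupport, hχ1, ⟨⟨|E| + 2, by positivity⟩, fun l => ?_⟩, ?_⟩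
  · change |l * χ l| ≤ |E| + 2
    rw [abs_mul]
    by_cases hl : |E| + 2 ≤ |l|
    · rw [χ.zero_of_le_dist (by simpa using hl), abs_zero, mul_zero]
      positivity
    · exact (mul_le_of_le_one_right (abs_nonneg _) (hχ1 l)).trans (not_le.1 hl).le
  · filter_upwards [h.fourier_eq] with ξ hξ
    rw [symbolMul, hξ]
    by_cases hs : ξ ∈ tsupport f
    · rw [χ.one_of_mem_closedBall, Complex.ofReal_one, one_mul]
      rw [mem_closedBall_zero_iff]
      exact (hE ξ hs).trans ((le_abs_self E).trans (by simp [χ]))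
    · rw [image_eq_zero_of_notMem_tsupport hs, mul_zero]

/-- Writing `Φ = (H₀ + 1)⁻¹Φ'` gives a bound uniform in time; it handles `|t| < 1`, where the
forbidden region gives no information. -/
theorem FastState.exists_mulNorm_le (hm : 0 < m) (h : FastState m s e Φ f) (a b : ℝ≥0) :
    ∃ C : ℝ, 0 ≤ C ∧ ∀ U : Space ν → ℝ, KatoWith m a b U → ∀ t : ℝ,
      mulNorm U (freeEvol m t Φ) ≤ ENNReal.ofReal C := by
  obtain ⟨Φ', f', -, hΦ'⟩ := h.exists_resolvent hm
  refine ⟨(a * 1 + b * 1 : ℝ≥0) * ‖Φ'‖, by positivity, fun U hU t => ?_⟩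
  rw [← hΦ']
  refine (hU.mulNorm_funcH0_le hm measurable_resolvent_symbol (fun _ => norm_resolvent_symbol_le)
    (fun _ => norm_mul_resolvent_symbol_le) _).trans ?_
  rw [ENNReal.ofReal_mul (NNReal.coe_nonneg _), ENNReal.ofReal_coe_nnreal, ofReal_norm]
  exact mul_le_mul_right (enorm_freeEvol_le hm t Φ') _

theorem FastState.exists_mulNorm_sub_le (hm : 0 < m) (h : FastState m s e Φ f) (a b : ℝ≥0)
    (N : ℕ) :
    ∃ C : ℝ, 0 ≤ C ∧ ∀ U : Space ν → ℝ, KatoWith m a b U → ∀ t : ℝ, 1 ≤ |t| →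
      mulNorm U (freeEvol m t Φ - cutSpace (s * |t|) (freeEvol m t Φ)) ≤
        ENNReal.ofReal (C * |t|⁻¹ ^ N) :=
  exists_mulNorm_sub_cutSpace_le hm h.speed_pos h.direction_le h.fourier_eq h.contDiff
    h.hasCompactSupport h.tsupport_subset a b N

theorem FastState.exists_mulNorm_funcH0_sub_le (hm : 0 < m) (h : FastState m s e Φ f)
    (a b : ℝ≥0) (N : ℕ) {c : ℝ → ℂ} (hc : Measurable c) {C₀ C₁ : ℝ≥0}
    (h0 : ∀ l : ℝ, 0 ≤ l → ‖c l‖ ≤ C₀) (h1 : ∀ l : ℝ, 0 ≤ l → ‖(l : ℂ) * c l‖ ≤ C₁) :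
    ∃ C : ℝ, 0 ≤ C ∧ ∀ U : Space ν → ℝ, KatoWith m a b U → ∀ t : ℝ, 1 ≤ |t| →
      mulNorm U (funcH0 m c (freeEvol m t Φ - cutSpace (s * |t|) (freeEvol m t Φ))) ≤
        ENNReal.ofReal (C * |t|⁻¹ ^ N) := by
  obtain ⟨C, hC, H⟩ := h.exists_mulNorm_sub_le hm 0 1 N
  refine ⟨(a * C₁ + b * C₀ : ℝ≥0) * C, by positivity, fun U hU t ht => ?_⟩
  refine (hU.mulNorm_funcH0_le hm hc h0 h1 _).trans ?_
  -- The potential `1` turns the estimate into smallness of the lagging part in norm; `U c(H₀)` is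
  -- bounded, which suffices.
  have h2 := H (fun _ => 1) (katoWith_of_bounded (by simp)) t ht
  have h3 : ∀ Ψ : Hilb ν, mulNorm (fun _ => 1) Ψ = ‖Ψ‖ₑ := fun Ψ => by
    simp [mulNorm, Lp.enorm_def]
  rw [h3] at h2
  rw [mul_assoc, ENNReal.ofReal_mul (NNReal.coe_nonneg _), ENNReal.ofReal_coe_nnreal]
  exact mul_le_mul_right h2 _

end

/-- The three alternative decay conditions on a potential, with the weight `ρ ^ κ`. -/
def DecayCondition (m : ℝ) (κ : ℕ) (U : Space ν → ℝ) : Prop :=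
  HasIntegrableBound (fun ρ => ENNReal.ofReal (ρ ^ κ) * mulOpNorm U (cutSpace ρ)) ∨
  HasIntegrableBound (fun ρ =>
    ENNReal.ofReal (ρ ^ κ) * mulOpNorm U (fun Ψ => resolvent m (cutSpace ρ Ψ))) ∨
  ∀ g : ℝ → ℝ, ContDiff ℝ ∞ g → HasCompactSupport g →
    HasIntegrableBound (fun ρ =>
      ENNReal.ofReal (ρ ^ κ) * mulOpNorm U (fun Ψ => cutH0 m g (cutSpace ρ Ψ)))

theorem DecayCondition.exists_integrable_bound (hm : 0 < m) {a b : ℝ≥0} {U : Space ν → ℝ}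
    (hU : AEMeasurable U volume) (hKU : KatoWith m a b U) {κ : ℕ} (hκ : DecayCondition m κ U)
    {Φ : Hilb ν} (hΦ : Φ ∈ goodStates ν m) :
    ∃ h : ℝ → ℝ, (∀ t, 0 < h t) ∧ Integrable h volume ∧ (∀ t, h |t| = h t) ∧
      ∀ (L : Space ν ≃ₗᵢ[ℝ] Space ν) (t : ℝ),
        ENNReal.ofReal ((1 + |t|) ^ κ) * mulNorm (fun x => U (L.symm x)) (freeEvol m t Φ) ≤
          ENNReal.ofReal (h t) := by
  obtain ⟨s, e, f, hf⟩ := exists_fastState hm hΦ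
  have hbd := hf.exists_mulNorm_le hm a b
  rcases hκ with h1 | h2 | h3
  · exact RotPot.exists_integrable_bound (A := LinearMap.id) hm (fun _ _ => rfl) hU hKU
      (fun _ => rfl) hf.speed_pos (hf.exists_mulNorm_sub_le hm a b (κ + 2)) hbd h1
  · obtain ⟨Φ', f', hf', hΦ'⟩ := hf.exists_resolvent hm
    have hdom := fun Ψ : Hilb ν => inDomain_of_bounded hm measurable_resolvent_symbol
      (fun _ => norm_resolvent_symbol_le) Ψ
    exact RotPot.exists_integrable_bound (A := funcH0ₗ m _ hdom) hm
      (fun L Ψ => funcH0_compL (hdom Ψ) L) hU hKU hΦ' hf.speed_pos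
      (hf'.exists_mulNorm_funcH0_sub_le hm a b (κ + 2) measurable_resolvent_symbol
        (fun _ => norm_resolvent_symbol_le) (fun _ => norm_mul_resolvent_symbol_le)) hbd h2
  · obtain ⟨g, hg, hgc, hg1, ⟨E, hE⟩, hgΦ⟩ := hf.exists_energy_cutoff
    have hgm : Measurable fun l => (g l : ℂ) :=
      (Complex.continuous_ofReal.comp hg.continuous).measurable
    have b0 : ∀ l : ℝ, 0 ≤ l → ‖(g l : ℂ)‖ ≤ ((1 : ℝ≥0) : ℝ) := fun l _ => by
      rw [Complex.norm_real]
      exact hg1 l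
    have b1 : ∀ l : ℝ, 0 ≤ l → ‖(l : ℂ) * (g l : ℂ)‖ ≤ E := fun l _ => by
      rw [← Complex.ofReal_mul, Complex.norm_real]
      exact hE l
    have hdom := fun Ψ : Hilb ν => inDomain_of_bounded hm hgm b0 Ψ
    exact RotPot.exists_integrable_bound (A := funcH0ₗ m _ hdom) hm
      (fun L Ψ => funcH0_compL (hdom Ψ) L) hU hKU
      (fun t => funcH0_freeEvol hm hdom hgΦ t) hf.speed_pos
      (hf.exists_mulNorm_funcH0_sub_le hm a b (κ + 2) hgm b0 b1) hbd (h3 g hg hgc)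

/-! ### Rotations and the time derivative of a rotating potential -/

variable {d : ℕ}

theorem norm_rotFun (θ : ℝ) (x : Space (d + 2)) : ‖rotFun θ x‖ = ‖x‖ := by
  rw [EuclideanSpace.norm_eq, EuclideanSpace.norm_eq]
  congr 1
  have h1 : ∀ k : Fin d, (k.succ.succ : Fin (d + 2)) ≠ 1 := fun k => by
    rw [← Fin.succ_zero_eq_one]
    exact fun h => Fin.succ_ne_zero k (Fin.succ_injective _ h)
  simp only [Fin.sum_univ_succ, rotFun, Fin.succ_ne_zero, if_true, if_false, h1,
    Fin.succ_zero_eq_one, Real.norm_eq_abs, sq_abs]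
  linear_combination (x 0 ^ 2 + x 1 ^ 2) * Real.sin_sq_add_cos_sq θ

/-- The rotation by the angle `θ` in the `x₁,x₂`-plane as a linear isometry. -/
def rotL (θ : ℝ) : Space (d + 2) ≃ₗᵢ[ℝ] Space (d + 2) where
  toFun := rotFun θ
  invFun := rotFun (-θ)
  left_inv := rotFun_neg_rotFun θ
  right_inv x := by simpa using rotFun_neg_rotFun (-θ) x
  map_add' x y := by
    ext k
    simp only [rotFun, PiLp.add_apply]
    split_ifs <;> ring
  map_smul' c x := by
    ext k
    simp only [rotFun, PiLp.smul_apply, smul_eq_mul, RingHom.id_apply]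
    split_ifs <;> ring
  norm_map' := norm_rotFun θ

theorem rotPotential_eq (Ω : ℝ) (V : Space (d + 2) → ℝ) (t : ℝ) :
    rotPotential Ω V t = fun x => V ((rotL (Ω * t)).symm x) := rfl

theorem hasDerivAt_rotFun_apply (Ω t : ℝ) (y : Space (d + 2)) (k : Fin (d + 2)) :
    HasDerivAt (fun s => rotFun (Ω * s) y k) ((Ω • azimuthalField (rotFun (Ω * t) y)) k) t := by
  have h0 : HasDerivAt (fun s : ℝ => Ω * s) Ω t := by
    simpa using (hasDerivAt_id t).const_mul Ω
  simp only [rotFun, azimuthalField, PiLp.smul_apply, smul_eq_mul, if_true, one_ne_zero, if_false]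
  split_ifs
  · convert! (h0.cos.mul_const (y 0)).sub (h0.sin.mul_const (y 1)) using 1
    ring
  · convert! (h0.sin.mul_const (y 0)).add (h0.cos.mul_const (y 1)) using 1
    ring
  · simpa using hasDerivAt_const t (y k)

theorem hasDerivAt_rotFun (Ω t : ℝ) (y : Space (d + 2)) :
    HasDerivAt (fun s => rotFun (Ω * s) y) (Ω • azimuthalField (rotFun (Ω * t) y)) t := by
  have hpi : HasDerivAt (fun s => (rotFun (Ω * s) y).ofLp)
      (Ω • azimuthalField (rotFun (Ω * t) y)).ofLp t := by
    rw [hasDerivAt_pi]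
    intro k
    exact hasDerivAt_rotFun_apply Ω t y k
  exact (PiLp.hasFDerivAt_toLp (𝕜 := ℝ) 2 _).comp_hasDerivAt t hpi

/-- The field generates the rotations, hence is invariant under them. -/
theorem rotL_azimuthalField (θ : ℝ) (y : Space (d + 2)) :
    rotL θ (azimuthalField y) = azimuthalField (rotL θ y) := by
  ext k
  change rotFun θ (azimuthalField y) k = azimuthalField (rotFun θ y) k
  simp only [rotFun, azimuthalField, if_true, one_ne_zero, if_false]
  split_ifs <;> ring

theorem continuous_azimuthalField : Continuous (azimuthalField (d := d)) := by
  refine (PiLp.continuous_toLp 2 _).comp (continuous_pi fun k => ?_)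
  split_ifs <;> fun_prop

theorem locallyIntegrable_comp_symm {ν : ℕ} {V : Space ν → ℝ} (hV : LocallyIntegrable V volume)
    (L : Space ν ≃ₗᵢ[ℝ] Space ν) : LocallyIntegrable (fun x => V (L.symm x)) volume := by
  rw [locallyIntegrable_iff]
  intro K hK
  have h1 : L.symm ⁻¹' (L.symm '' K) = K := preimage_image_eq K L.symm.injective
  rw [← h1]
  exact (L.symm.measurePreserving.integrableOn_comp_preimage
    L.symm.toHomeomorph.measurableEmbedding).2
      (hV.integrableOn_isCompact (hK.image L.symm.continuous))

theorem integral_comp_symm_mul {ν : ℕ} (V η : Space ν → ℝ) (L : Space ν ≃ₗᵢ[ℝ] Space ν) :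
    ∫ x, V (L.symm x) * η x = ∫ y, V y * η (L y) := by
  rw [← L.measurePreserving.integral_comp L.toHomeomorph.measurableEmbedding]
  simp

/-- After a change of variables the time dependence sits in the smooth test function and can be
differentiated under the integral. The result is `Ω ∂_φ` of the rotated test function; the weak
definition of `∂_φ V` supplies the minus sign. -/
theorem hasDerivAt_integral_rotPotential {Ω : ℝ} {V W : Space (d + 2) → ℝ}
    (h : IsAzimuthalDeriv V W) {η : Space (d + 2) → ℝ} (hη : ContDiff ℝ ∞ η)
    (hηc : HasCompactSupport η) (t : ℝ) :
    HasDerivAt (fun s => ∫ x, rotPotential Ω V s x * η x)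
      (∫ x, rotPotential Ω (fun y => -Ω * W y) t x * η x) t := by
  obtain ⟨hV, -, hVW⟩ := h
  simp only [rotPotential_eq, integral_comp_symm_mul,
    integral_comp_symm_mul (fun y => -Ω * W y)]
  have hηd : Differentiable ℝ η := hη.differentiable (by simp)
  set D : Space (d + 2) → ℝ := fun z => fderiv ℝ η z (Ω • azimuthalField z) with hD
  have hDc : Continuous D :=
    (hη.continuous_fderiv (by simp)).clm_apply (continuous_azimuthalField.const_smul Ω)
  have hDs : tsupport D ⊆ tsupport η := by
    refine closure_minimal (fun z hz => ?_) (isClosed_tsupport η)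
    refine tsupport_fderiv_subset ℝ (subset_tsupport _ fun h0 => hz ?_)
    simp [hD, h0]
  have hDcs : HasCompactSupport D := hηc.of_isClosed_subset (isClosed_tsupport D) hDs
  obtain ⟨M, hM⟩ := hDcs.exists_bound_of_continuous hDc
  -- Rotations preserve centred balls, so one ball contains all rotated supports and the dominating
  -- function is independent of `s`.
  obtain ⟨R, hR⟩ := hDcs.isCompact.isBounded.subset_closedBall (0 : Space (d + 2))
  have hderiv : ∀ (s : ℝ) (y : Space (d + 2)),
      HasDerivAt (fun s => V y * η (rotL (Ω * s) y)) (V y * D (rotL (Ω * s) y)) s := by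
    intro s y
    exact ((hηd _).hasFDerivAt.comp_hasDerivAt s (hasDerivAt_rotFun Ω s y)).const_mul (V y)
  have hbound : ∀ (s : ℝ) (y : Space (d + 2)), ‖V y * D (rotL (Ω * s) y)‖ ≤
      (Metric.closedBall (0 : Space (d + 2)) R).indicator (fun y => ‖V y‖ * M) y := by
    intro s y
    rw [norm_mul]
    by_cases hy : y ∈ Metric.closedBall (0 : Space (d + 2)) R
    · rw [indicator_of_mem hy]
      exact mul_le_mul_of_nonneg_left (hM _) (norm_nonneg _)
    · rw [indicator_of_notMem hy, image_eq_zero_of_notMem_tsupport (f := D), norm_zero, mul_zero]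
      intro hz
      refine hy ?_
      have := hR hz
      rw [mem_closedBall_zero_iff, LinearIsometryEquiv.norm_map] at this
      rwa [mem_closedBall_zero_iff]
  have hVm : AEStronglyMeasurable V volume := hV.aestronglyMeasurable
  have hi : Integrable (fun y => V y * η (rotL (Ω * t) y)) := by
    have h1 := hV.integrable_smul_left_of_hasCompactSupport
      (hη.continuous.comp (rotL (Ω * t)).continuous)
      (hηc.comp_homeomorph (rotL (Ω * t)).toHomeomorph)
    refine h1.congr (Filter.Eventually.of_forall fun y => ?_)
    simp [mul_comm]
  have key := (hasDerivAt_integral_of_dominated_loc_of_deriv_le (μ := volume)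
    (F := fun s y => V y * η (rotL (Ω * s) y)) (F' := fun s y => V y * D (rotL (Ω * s) y))
    (x₀ := t) Filter.univ_mem
    (Filter.Eventually.of_forall fun s => hVm.mul
      (hη.continuous.comp (rotL (Ω * s)).continuous).aestronglyMeasurable) hi
    (hVm.mul (hDc.comp (rotL (Ω * t)).continuous).aestronglyMeasurable)
    (Filter.Eventually.of_forall fun y s _ => hbound s y)
    (IntegrableOn.integrable_indicator ((hV.integrableOn_isCompact
      (isCompact_closedBall 0 R)).norm.mul_const M) measurableSet_closedBall)
    (Filter.Eventually.of_forall fun y s _ => hderiv s y)).2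
  convert! key using 1
  have hηL : ContDiff ℝ ∞ (fun y => η (rotL (Ω * t) y)) :=
    hη.comp (rotL (Ω * t)).contDiff
  have h2 := hVW _ hηL (hηc.comp_homeomorph (rotL (Ω * t)).toHomeomorph)
  have h3 : ∀ y, V y * D (rotL (Ω * t) y) =
      Ω * (V y * fderiv ℝ (fun y => η (rotL (Ω * t) y)) y (azimuthalField y)) := by
    intro y
    have h4 : HasFDerivAt (fun y => η (rotL (Ω * t) y))
        ((fderiv ℝ η (rotL (Ω * t) y)).comp
          ((rotL (d := d) (Ω * t)).toContinuousLinearEquiv :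
            Space (d + 2) →L[ℝ] Space (d + 2))) y :=
      (hηd _).hasFDerivAt.comp y (rotL (d := d) (Ω * t)).toContinuousLinearEquiv.hasFDerivAt
    have h5 : fderiv ℝ (fun y => η (rotL (Ω * t) y)) y (azimuthalField y) =
        fderiv ℝ η (rotL (Ω * t) y) (azimuthalField (rotL (Ω * t) y)) := by
      rw [h4.fderiv, ← rotL_azimuthalField]
      rfl
    rw [h5]
    simp only [hD, map_smul, smul_eq_mul]
    ring
  simp only [h3]
  rw [integral_const_mul, h2, mul_neg, ← neg_mul, ← integral_const_mul]
  simp only [mul_assoc]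

theorem isTimeDeriv_rotPotential {Ω : ℝ} {V W : Space (d + 2) → ℝ} (h : IsAzimuthalDeriv V W) :
    IsTimeDeriv (rotPotential Ω V) (rotPotential Ω fun y => -Ω * W y) :=
  ⟨fun t => locallyIntegrable_comp_symm h.1 (rotL (Ω * t)),
    fun t => locallyIntegrable_comp_symm (h.2.1.smul (-Ω)) (rotL (Ω * t)),
    fun _ hη hηc t => hasDerivAt_integral_rotPotential h hη hηc t⟩

theorem HasIntegrableBound.const_mul {w : ℝ → ℝ≥0∞} (hw : HasIntegrableBound w) (c : ℝ) :
    HasIntegrableBound fun ρ => ‖c‖ₑ * w ρ := by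
  obtain ⟨h, hi, hb⟩ := hw
  refine ⟨fun ρ => ‖c‖ * h ρ, hi.const_mul _, fun ρ hρ => ?_⟩
  rw [ENNReal.ofReal_mul (norm_nonneg c), ofReal_norm]
  exact mul_le_mul_right (hb ρ hρ) _

theorem DecayCondition.const_mul {ν : ℕ} {m : ℝ} {κ : ℕ} {U : Space ν → ℝ}
    (h : DecayCondition m κ U) (c : ℝ) : DecayCondition m κ fun x => c * U x := by
  simp only [DecayCondition, mulOpNorm_const_mul, mul_left_comm _ ‖c‖ₑ]
  exact h.imp (·.const_mul c) (Or.imp (·.const_mul c) fun H g hg hgc => (H g hg hgc).const_mul c)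

end RotPot

end

/-! ### The two decay statements -/

open RotPot in
theorem lemma2p2 (d : ℕ) (m Ω : ℝ) (hm : 0 < m) (V : Space (d + 2) → ℝ)
    (hV : AEMeasurable V volume) (hK : KatoBounded m V) :
    -- decay of `V` implies the decay of `V_t exp(-i t H₀) Φ`
    ((HasIntegrableBound (fun ρ => ENNReal.ofReal ρ * mulOpNorm V (cutSpace ρ)) ∨
      HasIntegrableBound (fun ρ =>
        ENNReal.ofReal ρ * mulOpNorm V (fun Ψ => resolvent m (cutSpace ρ Ψ))) ∨
      (∀ g : ℝ → ℝ, ContDiff ℝ ∞ g → HasCompactSupport g →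
        HasIntegrableBound (fun ρ =>
          ENNReal.ofReal ρ * mulOpNorm V (fun Ψ => cutH0 m g (cutSpace ρ Ψ))))) →
      ∀ Φ ∈ goodStates (d + 2) m,
        (∃ h : ℝ → ℝ, (∀ t, 0 < h t) ∧ Integrable h volume ∧
          ∀ t : ℝ, mulNorm (rotPotential Ω V t) (freeEvol m t Φ)
            ≤ ENNReal.ofReal (h t / (1 + |t|))) ∧
        (∃ h' : ℝ → ℝ, IntegrableOn h' (Ici 0) volume ∧
          ∀ t : ℝ, ENNReal.ofReal |t| * mulNorm (rotPotential Ω V t) (freeEvol m t Φ)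
            ≤ ENNReal.ofReal (h' |t|))) ∧
    -- decay of `∂_φ V` implies the decay of `∂_t V_t exp(-i t H₀) Φ`
    (∀ W : Space (d + 2) → ℝ, IsAzimuthalDeriv V W → MemLp W ∞ volume →
      (HasIntegrableBound (fun ρ => mulOpNorm W (cutSpace ρ)) ∨
        HasIntegrableBound (fun ρ => mulOpNorm W (fun Ψ => resolvent m (cutSpace ρ Ψ))) ∨
        (∀ g : ℝ → ℝ, ContDiff ℝ ∞ g → HasCompactSupport g →
          HasIntegrableBound (fun ρ => mulOpNorm W (fun Ψ => cutH0 m g (cutSpace ρ Ψ))))) →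
      ∃ Vdot : ℝ → Space (d + 2) → ℝ, IsTimeDeriv (rotPotential Ω V) Vdot ∧
        (∀ t, MemLp (Vdot t) ∞ volume) ∧
        ∀ Φ ∈ goodStates (d + 2) m,
          (∃ h : ℝ → ℝ, (∀ t, 0 < h t) ∧ Integrable h volume ∧
            ∀ t : ℝ, mulNorm (Vdot t) (freeEvol m t Φ) ≤ ENNReal.ofReal (h t)) ∧
          (∃ h' : ℝ → ℝ, IntegrableOn h' (Ici 0) volume ∧
            ∀ t : ℝ, mulNorm (Vdot t) (freeEvol m t Φ) ≤ ENNReal.ofReal (h' |t|))) := by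
  constructor
  · intro hdec Φ hΦ
    obtain ⟨a, b, -, hab⟩ := hK
    have hdec' : DecayCondition m 1 V := by
      simpa only [DecayCondition, pow_one] using hdec
    obtain ⟨h, h0, hi, he, hb⟩ := hdec'.exists_integrable_bound hm hV hab hΦ
    simp only [pow_one] at hb
    refine ⟨⟨h, h0, hi, fun t => ?_⟩, h, hi.integrableOn, fun t => ?_⟩
    · have ht : 0 < 1 + |t| := by positivity
      rw [ENNReal.ofReal_div_of_pos ht, ENNReal.le_div_iff_mul_le
        (Or.inl (ENNReal.ofReal_pos.2 ht).ne') (Or.inl ENNReal.ofReal_ne_top), mul_comm]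
      exact hb (rotL (Ω * t)) t
    -- Evenness of `h` and `|t| ≤ 1 + |t|` let the same function serve as the bound on the
    -- half-line.
    · rw [he]
      refine le_trans (mul_le_mul_left (ENNReal.ofReal_le_ofReal ?_) _) (hb (rotL (Ω * t)) t)
      linarith
  · intro W hW hWb hdec
    -- The essential bound supplies the Kato constants `0` and `b` for the time derivative,
    -- independently of those of `V`.
    have hWae : ∀ᵐ x, ‖-Ω * W x‖ ≤ (‖Ω‖₊ * (eLpNorm W ∞ volume).toNNReal : ℝ≥0) := by
      filter_upwards [enorm_ae_le_eLpNormEssSup W volume] with x hx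
      rw [← eLpNorm_exponent_top] at hx
      rw [norm_mul, norm_neg, NNReal.coe_mul, coe_nnnorm]
      refine mul_le_mul_of_nonneg_left ?_ (norm_nonneg _)
      rw [← coe_nnnorm, NNReal.coe_le_coe, ← ENNReal.coe_le_coe, ENNReal.coe_toNNReal hWb.2.ne]
      exact hx
    have hWm : AEMeasurable (fun x => -Ω * W x) volume := hWb.1.aemeasurable.const_mul _
    have hdec' : DecayCondition m 0 W := by
      simpa only [DecayCondition, pow_zero, ENNReal.ofReal_one, one_mul] using hdec
    refine ⟨rotPotential Ω fun y => -Ω * W y, isTimeDeriv_rotPotential hW, fun t => ?_,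
      fun Φ hΦ => ?_⟩
    · exact (hWb.const_mul (-Ω)).comp_measurePreserving (rotL (Ω * t)).symm.measurePreserving
    · obtain ⟨h, h0, hi, he, hb⟩ := (hdec'.const_mul (-Ω)).exists_integrable_bound hm hWm
        (katoWith_of_bounded hWae) hΦ
      simp only [pow_zero, ENNReal.ofReal_one, one_mul] at hb
      refine ⟨⟨h, h0, hi, fun t => hb (rotL (Ω * t)) t⟩, h, hi.integrableOn, fun t => ?_⟩
      rw [he]
      exact hb (rotL (Ω * t)) t
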